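/- An instance of the single-level discrete improvable knapsack problem (iK-ds) consists of $n\ge 0$ items with profits $p_i\in\mathbb{R}$, original weights $w_i$, improved weights $\hat w_i$ with $0\le \hat w_i\le w_i$, improvement costs $c_i\ge 0$, and budgets $B,C\ge 0$. The problem is $$\max\Big\{\sum_{i=1}^n p_i x_i \;:\; \sum_{i=1}^n w_i x_i-\sum_{i=1}^n (w_i-\hat w_i)y_i\le B,\ \sum_{i=1}^n c_i y_i\le C,\ y_i\le x_i,\ x,y\in\{0,1\}^n\Big\},$$ and $opt$ denotes its optimal value. Let $$\mathrm{MKP}^*=\max\Big\{\sum_i p_i z_i : \sum_i \hat w_i z_i\le B,\ \sum_i c_i z_i\le C,\ z\in\{0,1\}^n\Big\},\qquad \mathrm{KP}^*=\max\Big\{\sum_i p_i z_i : \sum_i w_i z_i\le B,\ z\in\{0,1\}^n\Big\}.$$ 1. For every instance, $opt\le 2\max\{\mathrm{MKP}^*,\mathrm{KP}^*\}$. 2. For every instance, if $z^1$ is feasible for the first of these two problems with $\mathrm{MKP}^*\le 3\sum_i p_i z^1_i$, and $z^2$ is feasible for the second with $\mathrm{KP}^*\le 2\sum_i p_i z^2_i$,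 then $(x,y)=(z^1,z^1)$ and $(x,y)=(z^2,0)$ are both feasible for (iK-ds), and $opt\le 6\max\{\sum_i p_i z^1_i,\sum_i p_i z^2_i\}$. 3. There is a $6$-approximation algorithm for (iK-ds) that runs in linear time: there are a program for the real RAM (unit-cost exact arithmetic $+,-,\cdot,/$ and comparison of real numbers, addition, truncated subtraction and comparison of natural numbers, indirect memory access, loops and procedure calls, no rounding of reals to integers) and a constant $K$ such that, for every $n$ and every instance with $n$ items, the program halts after at most $K(n+1)$ steps and outputs a feasible solution $(x,y)$ with $opt\le 6\sum_i p_i x_i$. -/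

import Mathlib

open scoped BigOperators

namespace ImprovableKnapsack

/-! ### The optimization problems -/

/-- A vector with entries in `{0, 1}`. -/
def IsBinary {n : ℕ} (x : Fin n → ℕ) : Prop := ∀ i, x i = 0 ∨ x i = 1

/-- The linear form `∑ i, a i * x i`. -/
def total {n : ℕ} (a : Fin n → ℝ) (x : Fin n → ℕ) : ℝ := ∑ i, a i * (x i : ℝ)

/-- An instance, with `n` items, of the improvable knapsack problem with discrete single-level
improvements. Profits are arbitrary reals. An item that cannot be improved is an item with
`wImp i = w i` and `c i = 0`. -/
structure Instance (n : ℕ) where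
  /-- profits -/
  p : Fin n → ℝ
  /-- original weights -/
  w : Fin n → ℝ
  /-- improved weights -/
  wImp : Fin n → ℝ
  /-- improvement costs -/
  c : Fin n → ℝ
  /-- knapsack budget -/
  B : ℝ
  /-- improvement budget -/
  C : ℝ
  wImp_nonneg : ∀ i, 0 ≤ wImp i
  wImp_le : ∀ i, wImp i ≤ w i
  c_nonneg : ∀ i, 0 ≤ c i
  B_nonneg : 0 ≤ B
  C_nonneg : 0 ≤ C

/-- Feasibility for (iK-ds): `x i` says whether item `i` is packed, `y i` whether it is improved. -/
structure Instance.Feasible {n : ℕ} (I : Instance n) (x y : Fin n → ℕ) : Prop where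
  weight : total I.w x - total (fun i => I.w i - I.wImp i) y ≤ I.B
  cost : total I.c y ≤ I.C
  coupling : ∀ i, y i ≤ x i
  binary_x : IsBinary x
  binary_y : IsBinary y

/-- The objective values of the feasible solutions of (iK-ds). -/
def Instance.values {n : ℕ} (I : Instance n) : Set ℝ :=
  {v | ∃ x y, I.Feasible x y ∧ v = total I.p x}

/-- The optimal objective value of (iK-ds); a maximum, see `Instance.isGreatest_opt`. -/
noncomputable def Instance.opt {n : ℕ} (I : Instance n) : ℝ := sSup I.values

/-- Feasibility for the 0/1 knapsack problem with weights `w` and budget `B`. -/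
def KPFeasible {n : ℕ} (w : Fin n → ℝ) (B : ℝ) (z : Fin n → ℕ) : Prop :=
  IsBinary z ∧ total w z ≤ B

/-- The optimal objective value of the 0/1 knapsack problem. -/
noncomputable def kpOpt {n : ℕ} (p w : Fin n → ℝ) (B : ℝ) : ℝ :=
  sSup {v | ∃ z, KPFeasible w B z ∧ v = total p z}

/-- Feasibility for the 2-dimensional 0/1 knapsack problem. -/
def MKPFeasible {n : ℕ} (w c : Fin n → ℝ) (B C : ℝ) (z : Fin n → ℕ) : Prop :=
  IsBinary z ∧ total w z ≤ B ∧ total c z ≤ C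

/-- The optimal objective value of the 2-dimensional 0/1 knapsack problem. -/
noncomputable def mkpOpt {n : ℕ} (p w c : Fin n → ℝ) (B C : ℝ) : ℝ :=
  sSup {v | ∃ z, MKPFeasible w c B C z ∧ v = total p z}

theorem finite_isBinary (n : ℕ) : {x : Fin n → ℕ | IsBinary x}.Finite := by
  have h : (Set.univ.pi fun _ : Fin n => ({0, 1} : Set ℕ)).Finite :=
    Set.Finite.pi fun _ => Set.toFinite _
  refine h.subset fun x hx => ?_
  intro i _
  simpa using hx i

theorem total_zero {n : ℕ} (a : Fin n → ℝ) : total a 0 = 0 := by simp [total]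

/-- The optimum of (iK-ds) is attained. -/
theorem Instance.isGreatest_opt {n : ℕ} (I : Instance n) : IsGreatest I.values I.opt := by
  have hfin : I.values.Finite := by
    refine ((finite_isBinary n).image fun x => total I.p x).subset ?_
    rintro v ⟨x, y, h, rfl⟩
    exact ⟨x, h.binary_x, rfl⟩
  have hne : I.values.Nonempty :=
    ⟨total I.p 0, 0, 0, ⟨by simpa [total_zero] using I.B_nonneg,
      by simpa [total_zero] using I.C_nonneg, fun _ => le_rfl, fun _ => Or.inl rfl,
      fun _ => Or.inl rfl⟩, rfl⟩
  exact ⟨hne.csSup_mem hfin, fun v hv => le_csSup hfin.bddAbove hv⟩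

/-- The optimum of the knapsack problem is attained. -/
theorem isGreatest_kpOpt {n : ℕ} (p w : Fin n → ℝ) {B : ℝ} (hB : 0 ≤ B) :
    IsGreatest {v | ∃ z, KPFeasible w B z ∧ v = total p z} (kpOpt p w B) := by
  have hfin : {v | ∃ z, KPFeasible w B z ∧ v = total p z}.Finite := by
    refine ((finite_isBinary n).image fun x => total p x).subset ?_
    rintro v ⟨z, h, rfl⟩
    exact ⟨z, h.1, rfl⟩
  have hne : {v | ∃ z, KPFeasible w B z ∧ v = total p z}.Nonempty :=
    ⟨total p 0, 0, ⟨fun _ => Or.inl rfl, by simpa [total_zero] using hB⟩, rfl⟩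
  exact ⟨hne.csSup_mem hfin, fun v hv => le_csSup hfin.bddAbove hv⟩

/-- The optimum of the 2-dimensional knapsack problem is attained. -/
theorem isGreatest_mkpOpt {n : ℕ} (p w c : Fin n → ℝ) {B C : ℝ} (hB : 0 ≤ B) (hC : 0 ≤ C) :
    IsGreatest {v | ∃ z, MKPFeasible w c B C z ∧ v = total p z} (mkpOpt p w c B C) := by
  have hfin : {v | ∃ z, MKPFeasible w c B C z ∧ v = total p z}.Finite := by
    refine ((finite_isBinary n).image fun x => total p x).subset ?_
    rintro v ⟨z, h, rfl⟩
    exact ⟨z, h.1, rfl⟩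
  have hne : {v | ∃ z, MKPFeasible w c B C z ∧ v = total p z}.Nonempty :=
    ⟨total p 0, 0, ⟨fun _ => Or.inl rfl, by simpa [total_zero] using hB,
      by simpa [total_zero] using hC⟩, rfl⟩
  exact ⟨hne.csSup_mem hfin, fun v hv => le_csSup hfin.bddAbove hv⟩

/-! ### The machine model: a real RAM with unit costs

The machine has registers for natural numbers (used for indices and counters) and for real
numbers, and one unbounded memory of each kind, which is accessed through an address held in a
natural-number register. Arithmetic on reals is exact; there is no rounding from reals to naturals
and no multiplication of naturals. A program is a fixed finite text that does not depend on the
size of the input. -/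

/-- A machine configuration. -/
structure Config where
  /-- natural-number registers -/
  nreg : ℕ → ℕ
  /-- real registers -/
  rreg : ℕ → ℝ
  /-- natural-number memory -/
  nmem : ℕ → ℕ
  /-- real memory -/
  rmem : ℕ → ℝ

/-- The elementary operations; `d` is a target register, `a` and `b` are argument registers. -/
inductive Op
  | natConst (d k : ℕ)
  | natCopy (d a : ℕ)
  | natAdd (d a b : ℕ)
  | natSub (d a b : ℕ)
  | natLoad (d a : ℕ)
  | natStore (a b : ℕ)
  | realConst (d : ℕ) (q : ℚ)
  | realCopy (d a : ℕ)
  | realAdd (d a b : ℕ)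
  | realSub (d a b : ℕ)
  | realMul (d a b : ℕ)
  | realDiv (d a b : ℕ)
  | realLoad (d a : ℕ)
  | realStore (a b : ℕ)

/-- The effect of an elementary operation. The difference of naturals is truncated at `0`, and
division by `0` returns `0`. -/
noncomputable def Op.apply (s : Config) : Op → Config
  | .natConst d k => { s with nreg := Function.update s.nreg d k }
  | .natCopy d a => { s with nreg := Function.update s.nreg d (s.nreg a) }
  | .natAdd d a b => { s with nreg := Function.update s.nreg d (s.nreg a + s.nreg b) }
  | .natSub d a b => { s with nreg := Function.update s.nreg d (s.nreg a - s.nreg b) }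
  | .natLoad d a => { s with nreg := Function.update s.nreg d (s.nmem (s.nreg a)) }
  | .natStore a b => { s with nmem := Function.update s.nmem (s.nreg a) (s.nreg b) }
  | .realConst d q => { s with rreg := Function.update s.rreg d (q : ℝ) }
  | .realCopy d a => { s with rreg := Function.update s.rreg d (s.rreg a) }
  | .realAdd d a b => { s with rreg := Function.update s.rreg d (s.rreg a + s.rreg b) }
  | .realSub d a b => { s with rreg := Function.update s.rreg d (s.rreg a - s.rreg b) }
  | .realMul d a b => { s with rreg := Function.update s.rreg d (s.rreg a * s.rreg b) }
  | .realDiv d a b => { s with rreg := Function.update s.rreg d (s.rreg a / s.rreg b) }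
  | .realLoad d a => { s with rreg := Function.update s.rreg d (s.rmem (s.nreg a)) }
  | .realStore a b => { s with rmem := Function.update s.rmem (s.nreg a) (s.rreg b) }

/-- The elementary tests, comparing two registers. -/
inductive Test
  | natLt (a b : ℕ)
  | natLe (a b : ℕ)
  | realLt (a b : ℕ)
  | realLe (a b : ℕ)

/-- The outcome of an elementary test. -/
def Test.Holds (s : Config) : Test → Prop
  | .natLt a b => s.nreg a < s.nreg b
  | .natLe a b => s.nreg a ≤ s.nreg b
  | .realLt a b => s.rreg a < s.rreg b
  | .realLe a b => s.rreg a ≤ s.rreg b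

/-- Program text: elementary operations, composition, conditionals, while-loops, and calls of
(possibly recursive) parameterless procedures. -/
inductive Cmd
  | skip
  | op (o : Op)
  | seq (c₁ c₂ : Cmd)
  | branch (t : Test) (c₁ c₂ : Cmd)
  | loop (t : Test) (c : Cmd)
  | call (j : ℕ)

/-- A program: a main command and a finite list of procedure bodies. -/
structure Program where
  /-- procedure bodies -/
  procs : List Cmd
  /-- main command -/
  main : Cmd

/-- `Exec procs c s k s'`: the command `c`, started in configuration `s`, halts after exactly `k`
steps in configuration `s'`. Each elementary operation, each evaluation of a test and each
procedure call is one step. All registers and memories are global. -/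
inductive Exec (procs : List Cmd) : Cmd → Config → ℕ → Config → Prop
  | skip (s : Config) : Exec procs .skip s 1 s
  | op (o : Op) (s : Config) : Exec procs (.op o) s 1 (o.apply s)
  | seq {c₁ c₂ : Cmd} {s s' s'' : Config} {k l : ℕ} :
      Exec procs c₁ s k s' → Exec procs c₂ s' l s'' → Exec procs (.seq c₁ c₂) s (k + l) s''
  | branch_true {t : Test} {c₁ c₂ : Cmd} {s s' : Config} {k : ℕ} :
      t.Holds s → Exec procs c₁ s k s' → Exec procs (.branch t c₁ c₂) s (k + 1) s'
  | branch_false {t : Test} {c₁ c₂ : Cmd} {s s' : Config} {k : ℕ} :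
      ¬ t.Holds s → Exec procs c₂ s k s' → Exec procs (.branch t c₁ c₂) s (k + 1) s'
  | loop_true {t : Test} {c : Cmd} {s s' s'' : Config} {k l : ℕ} :
      t.Holds s → Exec procs c s k s' → Exec procs (.loop t c) s' l s'' →
      Exec procs (.loop t c) s (k + l + 1) s''
  | loop_false {t : Test} {c : Cmd} {s : Config} :
      ¬ t.Holds s → Exec procs (.loop t c) s 1 s
  | call {j : ℕ} {c : Cmd} {s s' : Config} {k : ℕ} :
      procs[j]? = some c → Exec procs c s k s' → Exec procs (.call j) s (k + 1) s'

/-- Execution is deterministic: the number of steps and the final configuration are unique. -/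
theorem Exec.unique {procs : List Cmd} {c : Cmd} {s s₁ : Config} {k₁ : ℕ}
    (h₁ : Exec procs c s k₁ s₁) :
    ∀ {k₂ : ℕ} {s₂ : Config}, Exec procs c s k₂ s₂ → k₁ = k₂ ∧ s₁ = s₂ := by
  induction h₁ with
  | skip s => intro k₂ s₂ h; cases h; exact ⟨rfl, rfl⟩
  | op o s => intro k₂ s₂ h; cases h; exact ⟨rfl, rfl⟩
  | seq _ _ ih ih' =>
    intro k₂ s₂ h
    cases h with
    | seq g g' =>
      obtain ⟨rfl, rfl⟩ := ih g
      obtain ⟨rfl, rfl⟩ := ih' g'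
      exact ⟨rfl, rfl⟩
  | branch_true ht _ ih =>
    intro k₂ s₂ h
    cases h with
    | branch_true _ g => obtain ⟨rfl, rfl⟩ := ih g; exact ⟨rfl, rfl⟩
    | branch_false g _ => exact absurd ht g
  | branch_false ht _ ih =>
    intro k₂ s₂ h
    cases h with
    | branch_true g _ => exact absurd g ht
    | branch_false _ g => obtain ⟨rfl, rfl⟩ := ih g; exact ⟨rfl, rfl⟩
  | loop_true ht _ _ ih ih' =>
    intro k₂ s₂ h
    cases h with
    | loop_true _ g g' =>
      obtain ⟨rfl, rfl⟩ := ih g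
      obtain ⟨rfl, rfl⟩ := ih' g'
      exact ⟨rfl, rfl⟩
    | loop_false g => exact absurd ht g
  | loop_false ht =>
    intro k₂ s₂ h
    cases h with
    | loop_true g _ _ => exact absurd g ht
    | loop_false _ => exact ⟨rfl, rfl⟩
  | call hj _ ih =>
    intro k₂ s₂ h
    cases h with
    | call g g' =>
      obtain rfl := Option.some.inj (hj.symm.trans g)
      obtain ⟨rfl, rfl⟩ := ih g'
      exact ⟨rfl, rfl⟩

/-- The initial configuration for an instance: natural-number register `0` holds `n`, real
registers `0` and `1` hold the budgets `B` and `C`, and the real memory cells `4 * i`, ...,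
`4 * i + 3` hold the profit, the original weight, the improved weight and the improvement cost of
item `i`. Everything else is `0`. -/
noncomputable def Instance.input {n : ℕ} (I : Instance n) : Config where
  nreg := fun r => if r = 0 then n else 0
  rreg := fun r => if r = 0 then I.B else if r = 1 then I.C else 0
  nmem := fun _ => 0
  rmem := fun a =>
    if h : a / 4 < n then
      if a % 4 = 0 then I.p ⟨a / 4, h⟩
      else if a % 4 = 1 then I.w ⟨a / 4, h⟩
      else if a % 4 = 2 then I.wImp ⟨a / 4, h⟩
      else I.c ⟨a / 4, h⟩
    else 0

/-- The vector `x` that a halting configuration encodes: `x i` is in natural-number memory cell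
`2 * i`. -/
def Config.outX (s : Config) (n : ℕ) : Fin n → ℕ := fun i => s.nmem (2 * (i : ℕ))

/-- The vector `y` that a halting configuration encodes: `y i` is in natural-number memory cell
`2 * i + 1`. -/
def Config.outY (s : Config) (n : ℕ) : Fin n → ℕ := fun i => s.nmem (2 * (i : ℕ) + 1)

/-- `P` is a linear-time `ρ`-approximation algorithm for (iK-ds): there is a constant `K` such that
on every instance with `n` items `P` halts after at most `K * (n + 1)` steps and outputs a feasible
solution whose profit is at least the optimum divided by `ρ`. -/
def Program.IsLinearTimeApprox (P : Program) (ρ : ℝ) : Prop :=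
  ∃ K : ℕ, ∀ (n : ℕ) (I : Instance n), ∃ (k : ℕ) (s : Config),
    Exec P.procs P.main I.input k s ∧ k ≤ K * (n + 1) ∧
      I.Feasible (s.outX n) (s.outY n) ∧ I.opt ≤ ρ * total I.p (s.outX n)

end ImprovableKnapsack

namespace ImprovableKnapsack

/-! ### Comparison with the two knapsack problems -/

/-! For the first two claims, split an optimal `(x, y)` into the improved items `y` and the
unimproved items `x - y`. The capacity used is `ŵ(y) + w(x - y) ≤ B` with both terms nonnegative, so
`y` is feasible for the two-dimensional problem and `x - y` for the ordinary one. Hence `opt ≤ MKP*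
+ KP*` (`Instance.opt_le_add`), and both bounds follow.

The linear-time algorithm does not pass through these two problems, and in fact achieves ratio 4.
Each item gets one scalar size: the smaller of `w / B` (unimproved) and `v / B + c / C` (improved),
among the modes in which the item fits alone. Items that fit in no mode or have nonpositive profit
are discarded. A set of total size at most 1 respects both budgets
(`Instance.feasible_of_size_le_one`). Conversely, the positive-profit items of an optimum have total
size at most 2, one unit for each budget (`Instance.exists_opt_le`). So a one-dimensional knapsack
of capacity 1 is to be compared with one of capacity 2. Greedy packing by size per profit, together
with one item that did not fit, earns at least half of what any set of size 2 earns
(`Table.profit_le_of_isQuantile`). The better of the greedy set and the best single item therefore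
loses a factor of at most 4.

Greedy needs no sorting, only its threshold: the weighted quantile at level 1 of the keys size /
profit. It is found by recursive selection around the median of medians of medians of triples. This
pivot removes about two ninths of the list from either side, and it comes from a recursive call on
one ninth of the list. The two recursive calls thus handle at most about eight ninths of the list in
total, and the time is linear (`runs_select`).

The remaining lemmas show that the program text implements these steps within the stated numbers of
machine steps. -/

theorem total_add {n : ℕ} (a : Fin n → ℝ) (x y : Fin n → ℕ) :
    total a (x + y) = total a x + total a y := by
  simp [total, mul_add, Finset.sum_add_distrib]

theorem total_mono {n : ℕ} {a : Fin n → ℝ} (ha : ∀ i, 0 ≤ a i) {x y : Fin n → ℕ}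
    (h : ∀ i, x i ≤ y i) : total a x ≤ total a y :=
  Finset.sum_le_sum fun i _ => mul_le_mul_of_nonneg_left (by exact_mod_cast h i) (ha i)

theorem total_sub_left {n : ℕ} (a b : Fin n → ℝ) (x : Fin n → ℕ) :
    total (fun i => a i - b i) x = total a x - total b x := by
  simp [total, sub_mul, Finset.sum_sub_distrib]

/-- The improved and the unimproved items of an optimum are each a candidate for one of the two
problems, because the weights of both groups are nonnegative and together fit into `B`. -/
theorem Instance.opt_le_add {n : ℕ} (I : Instance n) :
    I.opt ≤ mkpOpt I.p I.wImp I.c I.B I.C + kpOpt I.p I.w I.B := by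
  obtain ⟨x, y, h, hv⟩ := I.isGreatest_opt.1
  -- The subtraction of naturals is exact here because `y ≤ x`.
  have hxy : x = y + (x - y) := by
    funext i
    have := h.coupling i
    simp only [Pi.add_apply, Pi.sub_apply]
    omega
  have hw : ∀ i, 0 ≤ I.w i := fun i => (I.wImp_nonneg i).trans (I.wImp_le i)
  have hweight := h.weight
  rw [total_sub_left, hxy, total_add] at hweight
  have hy : 0 ≤ total I.wImp y := by
    simpa [total_zero] using total_mono (x := 0) I.wImp_nonneg fun i => Nat.zero_le (y i)
  have hd : 0 ≤ total I.w (x - y) := by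
    simpa [total_zero] using total_mono (x := 0) hw fun i => Nat.zero_le ((x - y) i)
  have h₁ := (isGreatest_mkpOpt I.p I.wImp I.c I.B_nonneg I.C_nonneg).2
    ⟨y, ⟨h.binary_y, by linarith, h.cost⟩, rfl⟩
  have h₂ := (isGreatest_kpOpt I.p I.w I.B_nonneg).2
    ⟨x - y, ⟨fun i => by
      have := h.binary_x i
      simp only [Pi.sub_apply]
      omega, by linarith⟩, rfl⟩
  rw [hv, hxy, total_add]
  linarith

theorem Instance.opt_le_two_mul_max {n : ℕ} (I : Instance n) :
    I.opt ≤ 2 * max (mkpOpt I.p I.wImp I.c I.B I.C) (kpOpt I.p I.w I.B) := by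
  have h := I.opt_le_add
  have h₁ := le_max_left (mkpOpt I.p I.wImp I.c I.B I.C) (kpOpt I.p I.w I.B)
  have h₂ := le_max_right (mkpOpt I.p I.wImp I.c I.B I.C) (kpOpt I.p I.w I.B)
  linarith

theorem MKPFeasible.feasible {n : ℕ} {I : Instance n} {z : Fin n → ℕ}
    (h : MKPFeasible I.wImp I.c I.B I.C z) : I.Feasible z z where
  weight := by
    rw [total_sub_left]
    linarith [h.2.1]
  cost := h.2.2
  coupling _ := le_rfl
  binary_x := h.1
  binary_y := h.1

theorem KPFeasible.feasible {n : ℕ} {I : Instance n} {z : Fin n → ℕ}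
    (h : KPFeasible I.w I.B z) : I.Feasible z 0 where
  weight := by simpa [total_zero] using h.2
  cost := by simpa [total_zero] using I.C_nonneg
  coupling _ := Nat.zero_le _
  binary_x := h.1
  binary_y _ := Or.inl rfl

theorem Instance.opt_le_six_mul_max {n : ℕ} (I : Instance n) {z₁ z₂ : Fin n → ℕ}
    (h₁ : mkpOpt I.p I.wImp I.c I.B I.C ≤ 3 * total I.p z₁)
    (h₂ : kpOpt I.p I.w I.B ≤ 2 * total I.p z₂) :
    I.opt ≤ 6 * max (total I.p z₁) (total I.p z₂) := by
  -- Profits may be negative, so weakening 2 to 3 needs `total I.p z₂ ≥ 0`. This follows from `0 ≤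
  -- kpOpt`, the empty packing being feasible.
  have hz : kpOpt I.p I.w I.B ≤ 3 * total I.p z₂ := by
    have : 0 ≤ kpOpt I.p I.w I.B := (isGreatest_kpOpt I.p I.w I.B_nonneg).2
      ⟨0, ⟨fun _ => Or.inl rfl, by simpa [total_zero] using I.B_nonneg⟩, (total_zero _).symm⟩
    linarith
  have h := I.opt_le_add
  have h₁ := le_max_left (total I.p z₁) (total I.p z₂)
  have h₂ := le_max_right (total I.p z₁) (total I.p z₂)
  linarith

/-! ### Weighted selection on lists of pairs (key, weight) -/

/-- Total weight of the keys below `θ`. -/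
noncomputable def weightLt (θ : ℝ) (l : List (ℝ × ℝ)) : ℝ :=
  (l.map fun x => if x.1 < θ then x.2 else 0).sum

/-- Total weight of the keys equal to `θ`. -/
noncomputable def weightEq (θ : ℝ) (l : List (ℝ × ℝ)) : ℝ :=
  (l.map fun x => if x.1 = θ then x.2 else 0).sum

/-- Total weight. -/
noncomputable def weight (l : List (ℝ × ℝ)) : ℝ := (l.map Prod.snd).sum

/-- `θ` is the weighted quantile of `l` at level `τ`, and `R` is the room left by the keys
below `θ`. -/
structure IsQuantile (l : List (ℝ × ℝ)) (τ θ R : ℝ) : Prop where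
  room : R = τ - weightLt θ l
  nonneg : 0 ≤ R
  lt : R < weightEq θ l

/-- This and the next five lemmas relate the masses of the two parts around a pivot `θ` to those of
the whole list: the lower part keeps them below the pivot, the upper part shifts them by the mass at
or below it. -/
theorem weight_filter_lt (θ : ℝ) (l : List (ℝ × ℝ)) :
    weight (l.filter fun x => decide (x.1 < θ)) = weightLt θ l := by
  induction l with
  | nil => simp [weight, weightLt]
  | cons x l ih =>
    simp only [weight, weightLt] at ih ⊢
    by_cases h : x.1 < θ <;> simp [h, ih]

theorem weight_filter_gt (θ : ℝ) (l : List (ℝ × ℝ)) :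
    weight (l.filter fun x => decide (θ < x.1)) = weight l - weightLt θ l - weightEq θ l := by
  induction l with
  | nil => simp [weight, weightLt, weightEq]
  | cons x l ih =>
    simp only [weight, weightLt, weightEq] at ih ⊢
    rcases lt_trichotomy x.1 θ with h | h | h
    · simp [h, h.ne, h.not_gt, ih]
    · simp [h, ih]
      ring
    · simp [h, h.ne', h.not_gt, ih]
      ring

theorem weightLt_filter_lt {θ θ' : ℝ} (h : θ' ≤ θ) (l : List (ℝ × ℝ)) :
    weightLt θ' (l.filter fun x => decide (x.1 < θ)) = weightLt θ' l := by
  induction l with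
  | nil => rfl
  | cons x l ih =>
    simp only [weightLt] at ih ⊢
    by_cases hx : x.1 < θ
    · simp [hx, ih]
    · simp [hx, (h.trans (not_lt.1 hx)).not_gt, ih]

theorem weightEq_filter_lt {θ θ' : ℝ} (h : θ' < θ) (l : List (ℝ × ℝ)) :
    weightEq θ' (l.filter fun x => decide (x.1 < θ)) = weightEq θ' l := by
  induction l with
  | nil => rfl
  | cons x l ih =>
    simp only [weightEq] at ih ⊢
    by_cases hx : x.1 < θ
    · simp [hx, ih]
    · simp [hx, (h.trans_le (not_lt.1 hx)).ne', ih]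

theorem weightLt_filter_gt {θ θ' : ℝ} (h : θ < θ') (l : List (ℝ × ℝ)) :
    weightLt θ' (l.filter fun x => decide (θ < x.1)) =
      weightLt θ' l - weightLt θ l - weightEq θ l := by
  induction l with
  | nil => simp [weightLt, weightEq]
  | cons x l ih =>
    simp only [weightLt, weightEq] at ih ⊢
    rcases lt_trichotomy x.1 θ with hx | hx | hx
    · simp [hx, hx.ne, hx.not_gt, hx.trans h, ih]
    · simp [hx, h, ih]
      ring
    · simp [hx, hx.ne', hx.not_gt, ih]
      ring

theorem weightEq_filter_gt {θ θ' : ℝ} (h : θ < θ') (l : List (ℝ × ℝ)) :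
    weightEq θ' (l.filter fun x => decide (θ < x.1)) = weightEq θ' l := by
  induction l with
  | nil => rfl
  | cons x l ih =>
    simp only [weightEq] at ih ⊢
    by_cases hx : θ < x.1
    · simp [hx, ih]
    · simp [hx, ((not_lt.1 hx).trans_lt h).ne, ih]

theorem weightEq_of_forall_ne {θ : ℝ} {l : List (ℝ × ℝ)} (h : ∀ x ∈ l, x.1 ≠ θ) :
    weightEq θ l = 0 := by
  unfold weightEq
  exact List.sum_eq_zero fun y hy => by
    obtain ⟨x, hx, rfl⟩ := List.mem_map.1 hy
    simp [h x hx]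

/-- Since `0 ≤ R < weightEq`, a quantile must occur among the keys. So `θ'` lies strictly below the
pivot, where the discarded pairs contribute nothing. -/
theorem IsQuantile.of_filter_lt {l : List (ℝ × ℝ)} {τ θ θ' R : ℝ}
    (h : IsQuantile (l.filter fun x => decide (x.1 < θ)) τ θ' R) : IsQuantile l τ θ' R := by
  have hθ : θ' < θ := by
    by_contra! hθ
    have := weightEq_of_forall_ne (θ := θ') (l := l.filter fun x => decide (x.1 < θ))
      fun x hx => ((of_decide_eq_true (List.mem_filter.1 hx).2).trans_le hθ).ne
    linarith [h.nonneg, h.lt]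
  refine ⟨?_, h.nonneg, ?_⟩
  · rw [← weightLt_filter_lt hθ.le]
    exact h.room
  · rw [← weightEq_filter_lt hθ]
    exact h.lt

/-- The mirror case: the discarded mass at or below the pivot has been taken off the level. -/
theorem IsQuantile.of_filter_gt {l : List (ℝ × ℝ)} {τ θ θ' R : ℝ}
    (h : IsQuantile (l.filter fun x => decide (θ < x.1)) (τ - weightLt θ l - weightEq θ l) θ' R) :
    IsQuantile l τ θ' R := by
  have hθ : θ < θ' := by
    by_contra! hθ
    have := weightEq_of_forall_ne (θ := θ') (l := l.filter fun x => decide (θ < x.1))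
      fun x hx => (hθ.trans_lt (of_decide_eq_true (List.mem_filter.1 hx).2)).ne'
    linarith [h.nonneg, h.lt]
  refine ⟨?_, h.nonneg, ?_⟩
  · have := h.room
    rw [weightLt_filter_gt hθ] at this
    linarith
  · rw [← weightEq_filter_gt hθ]
    exact h.lt

/-! ### Medians of triples and the quality of the pivot -/

/-- The median of three numbers. -/
noncomputable def medianThree (a b c : ℝ) : ℝ := max (min a b) (min (max a b) c)

/-- The medians, with weight `1`, of the consecutive triples of keys. -/
noncomputable def medians : List (ℝ × ℝ) → List (ℝ × ℝ)
  | x :: y :: z :: l => (medianThree x.1 y.1 z.1, 1) :: medians l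
  | _ => []

theorem length_medians : ∀ l : List (ℝ × ℝ), (medians l).length = l.length / 3
  | x :: y :: z :: l => by
    simp only [medians, List.length_cons, length_medians l]
    omega
  | [] | [_] | [_, _] => by simp [medians]

/-- A median of three is at most `θ` only if two of the three are. Pairs left over after the last
full triple can only increase the right-hand side. -/
theorem countP_le_medians (θ : ℝ) : ∀ l : List (ℝ × ℝ),
    2 * (medians l).countP (fun x => decide (x.1 ≤ θ)) ≤ l.countP fun x => decide (x.1 ≤ θ)
  | x :: y :: z :: l => by
    have ih := countP_le_medians θ l
    simp only [medians, List.countP_cons, decide_eq_true_eq, medianThree, max_le_iff, min_le_iff]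
    split_ifs <;> first | omega | (exfalso; tauto)
  | [] | [_] | [_, _] => by simp [medians]

theorem countP_ge_medians (θ : ℝ) : ∀ l : List (ℝ × ℝ),
    2 * (medians l).countP (fun x => decide (θ ≤ x.1)) ≤ l.countP fun x => decide (θ ≤ x.1)
  | x :: y :: z :: l => by
    have ih := countP_ge_medians θ l
    simp only [medians, List.countP_cons, decide_eq_true_eq, medianThree, le_max_iff, le_min_iff]
    split_ifs <;> first | omega | (exfalso; tauto)
  | [] | [_] | [_, _] => by simp [medians]

theorem snd_eq_one_of_mem_medians : ∀ {l : List (ℝ × ℝ)} {x : ℝ × ℝ}, x ∈ medians l → x.2 = 1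
  | _ :: _ :: _ :: l, x, h => by
    rcases List.mem_cons.1 h with rfl | h
    · rfl
    · exact snd_eq_one_of_mem_medians h
  | [], _, h | [_], _, h | [_, _], _, h => by simp [medians] at h

/-- Unit weights turn masses into counts, so the quantile at half the length is an ordinary median.
-/
theorem weightLt_eq_countP {l : List (ℝ × ℝ)} (hl : ∀ x ∈ l, x.2 = 1) (θ : ℝ) :
    weightLt θ l + l.countP (fun x => decide (θ ≤ x.1)) = l.length := by
  induction l with
  | nil => simp [weightLt]
  | cons x l ih =>
    have := ih fun y hy => hl y (List.mem_cons_of_mem _ hy)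
    have hx := hl x List.mem_cons_self
    simp only [weightLt, List.map_cons, List.sum_cons, List.countP_cons, decide_eq_true_eq,
      List.length_cons] at this ⊢
    by_cases h : x.1 < θ
    · simp [h, h.not_ge, hx]
      linarith
    · simp [h, not_lt.1 h]
      linarith

theorem weightLt_add_weightEq_eq_countP {l : List (ℝ × ℝ)} (hl : ∀ x ∈ l, x.2 = 1) (θ : ℝ) :
    weightLt θ l + weightEq θ l = l.countP fun x => decide (x.1 ≤ θ) := by
  induction l with
  | nil => simp [weightLt, weightEq]
  | cons x l ih =>
    have := ih fun y hy => hl y (List.mem_cons_of_mem _ hy)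
    have hx := hl x List.mem_cons_self
    simp only [weightLt, weightEq, List.map_cons, List.sum_cons, List.countP_cons,
      decide_eq_true_eq] at this ⊢
    rcases lt_trichotomy x.1 θ with h | h | h
    · simp [h, h.ne, h.le, hx]
      linarith
    · simp [h, hx]
      linarith
    · simp [h.ne', h.not_gt, h.not_ge]
      linarith

/-- The median of medians of medians splits off two ninths of the list on either side. -/
theorem IsQuantile.length_filter_le {l : List (ℝ × ℝ)} {θ R : ℝ}
    (h : IsQuantile (medians (medians l)) ((l.length / 9 : ℕ) / 2 : ℝ) θ R) :
    (l.filter fun x => decide (x.1 < θ)).length + 2 * (l.length / 9) ≤ l.length ∧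
    (l.filter fun x => decide (θ < x.1)).length + 2 * (l.length / 9) ≤ l.length := by
  have hlen : (medians (medians l)).length = l.length / 9 := by
    rw [length_medians, length_medians, Nat.div_div_eq_div_mul]
  have hone : ∀ x ∈ medians (medians l), x.2 = 1 := fun x => snd_eq_one_of_mem_medians
  have h₁ := weightLt_eq_countP hone θ
  have h₂ := weightLt_add_weightEq_eq_countP hone θ
  have h₃ := (countP_ge_medians θ (medians l))
  have h₄ := countP_ge_medians θ l
  have h₅ := (countP_le_medians θ (medians l))
  have h₆ := countP_le_medians θ l
  have hroom := h.room
  have hR := h.nonneg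
  have hlt := h.lt
  rw [hlen] at h₁
  -- `R ≥ 0` says that at most half of the medians of medians are below `θ`, and `R < weightEq` that
  -- more than half are at most `θ`. Each of the two rounds of triples doubles these counts, so half
  -- of `l.length / 9` becomes two ninths of the list on either side.
  have h₇ : l.length / 9 ≤ 2 * (medians (medians l)).countP fun x => decide (θ ≤ x.1) := by
    have : ((l.length / 9 : ℕ) : ℝ) ≤
        2 * ((medians (medians l)).countP fun x => decide (θ ≤ x.1) : ℕ) := by linarith
    exact_mod_cast this
  have h₈ : l.length / 9 ≤ 2 * (medians (medians l)).countP fun x => decide (x.1 ≤ θ) := by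
    have : ((l.length / 9 : ℕ) : ℝ) ≤
        2 * ((medians (medians l)).countP fun x => decide (x.1 ≤ θ) : ℕ) := by linarith
    exact_mod_cast this
  have h₉ := List.length_eq_countP_add_countP (l := l) fun x => decide (θ ≤ x.1)
  have h₁₀ := List.length_eq_countP_add_countP (l := l) fun x => decide (x.1 ≤ θ)
  simp only [decide_eq_true_eq, not_le] at h₉ h₁₀
  rw [← List.countP_eq_length_filter, ← List.countP_eq_length_filter]
  omega

/-! ### Reasoning about programs -/

/-- Started in `s`, the command `c` halts after at most `K` steps in a configuration that
satisfies `Q`. -/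
def Runs (procs : List Cmd) (c : Cmd) (s : Config) (K : ℕ) (Q : Config → Prop) : Prop :=
  ∃ k s', Exec procs c s k s' ∧ k ≤ K ∧ Q s'

namespace Runs

variable {procs : List Cmd} {c c₁ c₂ : Cmd} {s : Config} {K L : ℕ} {Q R : Config → Prop}

theorem mono (h : Runs procs c s K R) (hK : K ≤ L) (hQ : ∀ s', R s' → Q s') :
    Runs procs c s L Q := by
  obtain ⟨k, s', h, hk, hR⟩ := h
  exact ⟨k, s', h, hk.trans hK, hQ _ hR⟩

theorem skip (h : Q s) : Runs procs .skip s 1 Q := ⟨1, s, .skip s, le_rfl, h⟩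

theorem op {o : Op} (h : Q (o.apply s)) : Runs procs (.op o) s 1 Q :=
  ⟨1, _, .op o s, le_rfl, h⟩

theorem seq (h₁ : Runs procs c₁ s K R) (h₂ : ∀ s', R s' → Runs procs c₂ s' L Q) :
    Runs procs (.seq c₁ c₂) s (K + L) Q := by
  obtain ⟨k, s', h, hk, hR⟩ := h₁
  obtain ⟨l, s'', h', hl, hQ⟩ := h₂ s' hR
  exact ⟨k + l, s'', .seq h h', by omega, hQ⟩

theorem op_seq {o : Op} (h : Runs procs c (o.apply s) K Q) :
    Runs procs (.seq (.op o) c) s (K + 1) Q := by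
  obtain ⟨k, s', h, hk, hQ⟩ := h
  exact ⟨1 + k, s', .seq (.op o s) h, by omega, hQ⟩

theorem branch {t : Test} (h₁ : t.Holds s → Runs procs c₁ s K Q)
    (h₂ : ¬ t.Holds s → Runs procs c₂ s K Q) : Runs procs (.branch t c₁ c₂) s (K + 1) Q := by
  by_cases ht : t.Holds s
  · obtain ⟨k, s', h, hk, hQ⟩ := h₁ ht
    exact ⟨k + 1, s', .branch_true ht h, by omega, hQ⟩
  · obtain ⟨k, s', h, hk, hQ⟩ := h₂ ht
    exact ⟨k + 1, s', .branch_false ht h, by omega, hQ⟩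

theorem loop_true {t : Test} (ht : t.Holds s) (h₁ : Runs procs c s K R)
    (h₂ : ∀ s', R s' → Runs procs (.loop t c) s' L Q) :
    Runs procs (.loop t c) s (K + L + 1) Q := by
  obtain ⟨k, s', h, hk, hR⟩ := h₁
  obtain ⟨l, s'', h', hl, hQ⟩ := h₂ s' hR
  exact ⟨k + l + 1, s'', .loop_true ht h h', by omega, hQ⟩

theorem loop_false {t : Test} (ht : ¬ t.Holds s) (h : Q s) : Runs procs (.loop t c) s 1 Q :=
  ⟨1, s, .loop_false ht, le_rfl, h⟩

theorem call {j : ℕ} (hj : procs[j]? = some c) (h : Runs procs c s K Q) :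
    Runs procs (.call j) s (K + 1) Q := by
  obtain ⟨k, s', h, hk, hQ⟩ := h
  exact ⟨k + 1, s', .call hj h, by omega, hQ⟩

/-- A loop that runs through the indices `k, …, n - 1`. -/
theorem count_loop {t : Test} {n : ℕ} {Inv : ℕ → Config → Prop}
    (ht : ∀ k s, k ≤ n → Inv k s → (t.Holds s ↔ k < n))
    (hc : ∀ k s, k < n → Inv k s → Runs procs c s K (Inv (k + 1))) (h : Inv 0 s) :
    Runs procs (.loop t c) s ((K + 1) * n + 1) (Inv n) := by
  suffices H : ∀ m k s, k + m = n → Inv k s →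
      Runs procs (.loop t c) s ((K + 1) * m + 1) (Inv n) from H n 0 s (by omega) h
  intro m
  induction m with
  | zero =>
    intro k s hk h
    obtain rfl : k = n := by omega
    simpa using loop_false (procs := procs) (c := c)
      (fun h' => lt_irrefl _ ((ht _ s le_rfl h).1 h')) h
  | succ m ih =>
    intro k s hk h
    refine (loop_true ((ht k s (by omega) h).2 (by omega)) (hc k s (by omega) h)
      fun s' h' => ih (k + 1) s' (by omega) h').mono ?_ fun _ => id
    ring_nf
    omega

end Runs

local infixr:60 " ;; " => Cmd.seq

/-! ### Lists of pairs in the real memory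

Natural-number registers `1` and `2` hold the first address of the current list and the address
after its last cell; registers `5`, …, `9` of either kind are scratch space. Natural-number
register `3` is the pointer of the stack of the selection procedure. Real registers `2`, `3` and
`4` hold the level of the quantile, the quantile, and the room left by the keys below it. -/

/-- The cells from address `a` on hold the keys and weights of `l`. -/
def ListAt (mem : ℕ → ℝ) : ℕ → List (ℝ × ℝ) → Prop
  | _, [] => True
  | a, x :: l => mem a = x.1 ∧ mem (a + 1) = x.2 ∧ ListAt mem (a + 2) l

/-- Frame rule: writes outside the occupied cells do not matter. -/
theorem ListAt.congr {mem mem' : ℕ → ℝ} : ∀ {l : List (ℝ × ℝ)} {a : ℕ}, ListAt mem a l →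
    (∀ i, a ≤ i → i < a + 2 * l.length → mem' i = mem i) → ListAt mem' a l
  | [], _, _, _ => trivial
  | x :: l, a, h, hm => by
    simp only [List.length_cons] at hm
    refine ⟨(hm a le_rfl (by omega)).trans h.1, (hm (a + 1) (by omega) (by omega)).trans h.2.1,
      h.2.2.congr fun i h₁ h₂ => hm i (by omega) (by omega)⟩

theorem ListAt.append {mem : ℕ → ℝ} : ∀ {l l' : List (ℝ × ℝ)} {a : ℕ}, ListAt mem a l →
    ListAt mem (a + 2 * l.length) l' → ListAt mem a (l ++ l')
  | [], _, _, _, h' => by simpa using h'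
  | x :: l, l', a, h, h' => by
    refine ⟨h.1, h.2.1, h.2.2.append ?_⟩
    convert h' using 1
    simp only [List.length_cons]
    omega

/-- The current list is `l`. -/
structure Config.HasList (s : Config) (l : List (ℝ × ℝ)) : Prop where
  listAt : ListAt s.rmem (s.nreg 1) l
  finish : s.nreg 2 = s.nreg 1 + 2 * l.length

/-- `s'` differs from `s` only in the scratch registers and the real memory. -/
structure ScratchOnly (s s' : Config) : Prop where
  nreg : ∀ r, r < 5 ∨ 10 ≤ r → s'.nreg r = s.nreg r
  rreg : ∀ r, r < 4 ∨ 10 ≤ r → s'.rreg r = s.rreg r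
  nmem : s'.nmem = s.nmem

theorem ScratchOnly.refl (s : Config) : ScratchOnly s s := ⟨fun _ _ => rfl, fun _ _ => rfl, rfl⟩

theorem ScratchOnly.trans {s s' s'' : Config} (h : ScratchOnly s s') (h' : ScratchOnly s' s'') :
    ScratchOnly s s'' :=
  ⟨fun r hr => (h'.nreg r hr).trans (h.nreg r hr), fun r hr => (h'.rreg r hr).trans (h.rreg r hr),
    h'.nmem.trans h.nmem⟩

/-! ### Filtering a list in memory -/

/-- Copies the pairs that pass the test `t` on the key, in real register `5`. -/
def filterBody (t : Test) : Cmd :=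
  .op (.realLoad 5 5) ;; .op (.natConst 7 1) ;; .op (.natAdd 5 5 7) ;; .op (.realLoad 6 5) ;;
  .op (.natAdd 5 5 7) ;;
  .branch t (.op (.realStore 6 5) ;; .op (.natAdd 6 6 7) ;; .op (.realStore 6 6) ;;
    .op (.natAdd 6 6 7)) .skip

/-- The writing pointer (register `6`) starts beyond the end of the list and only grows, so no
unread pair is overwritten and induction along the list applies. Each pair costs at most 10 steps
for the body and one for the loop test. -/
theorem runs_filter_loop {procs : List Cmd} {t : Test} {r : ℝ → ℝ → Bool}
    (ht : ∀ s, t.Holds s ↔ r (s.rreg 5) (s.rreg 3)) (l : List (ℝ × ℝ)) :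
    ∀ s : Config, ListAt s.rmem (s.nreg 5) l → s.nreg 2 = s.nreg 5 + 2 * l.length →
      s.nreg 2 < s.nreg 6 →
      Runs procs (.loop (.natLt 5 2) (filterBody t)) s (11 * l.length + 1) fun s' =>
        ScratchOnly s s' ∧ ListAt s'.rmem (s.nreg 6) (l.filter fun x => r x.1 (s.rreg 3)) ∧
        s'.nreg 6 = s.nreg 6 + 2 * (l.filter fun x => r x.1 (s.rreg 3)).length ∧
        ∀ a < s.nreg 6, s'.rmem a = s.rmem a := by
  induction l with
  | nil =>
    intro s hl hs hj
    refine Runs.loop_false ?_ ⟨.refl s, trivial, rfl, fun _ _ => rfl⟩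
    simp at hs
    simp [Test.Holds, hs]
  | cons x l ih =>
    intro s hl hs hj
    obtain ⟨h₁, h₂, h₃⟩ := hl
    simp only [List.length_cons] at hs
    refine (Runs.loop_true (K := 10) (L := 11 * l.length + 1) (R := fun s' =>
      ScratchOnly s s' ∧ s'.nreg 5 = s.nreg 5 + 2 ∧
      s'.nreg 6 = s.nreg 6 + (if r x.1 (s.rreg 3) then 2 else 0) ∧
      (r x.1 (s.rreg 3) → s'.rmem (s.nreg 6) = x.1 ∧ s'.rmem (s.nreg 6 + 1) = x.2) ∧
      ∀ a < s.nreg 6, s'.rmem a = s.rmem a) ?_ ?_ ?_).mono ?_ fun _ => id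
    · simp only [Test.Holds]
      omega
    · refine Runs.mono (.op_seq <| .op_seq <| .op_seq <| .op_seq <| .op_seq <|
        .branch (K := 4) (fun h => ?_) (fun h => ?_)) (by omega) fun _ => id
      · refine .op_seq <| .op_seq <| .op_seq <| .op ?_
        have hr : r x.1 (s.rreg 3) = true := by
          rw [ht] at h
          simpa [Op.apply, Function.update_apply, h₁] using h
        refine ⟨⟨?_, ?_, ?_⟩, ?_, ?_, ?_, ?_⟩
        all_goals simp [Op.apply, Function.update_apply, h₁, h₂, hr]
        all_goals grind
      · refine Runs.mono (.skip ?_) (show 1 ≤ 4 by omega) fun _ => id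
        have hr : r x.1 (s.rreg 3) = false := by
          rw [ht] at h
          simpa [Op.apply, Function.update_apply, h₁] using h
        refine ⟨⟨?_, ?_, ?_⟩, ?_, ?_, ?_, ?_⟩
        all_goals simp [Op.apply, Function.update_apply, h₁, h₂, hr]
        all_goals grind
    · rintro s' ⟨hf, h5, h6, hx, hm⟩
      have h2 := hf.nreg 2 (by omega)
      have hθ := hf.rreg 3 (by omega)
      refine (ih s' ?_ (by omega) (by omega)).mono le_rfl ?_
      · rw [h5]
        exact h₃.congr fun i _ hi => hm i (by omega)
      · rintro s'' ⟨hf', hl', h6', hm'⟩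
        rw [hθ] at hl' h6'
        refine ⟨hf.trans hf', ?_, ?_, fun a ha => ?_⟩
        · by_cases hr : r x.1 (s.rreg 3)
          · rw [List.filter_cons_of_pos (by simpa using hr)]
            simp only [hr, if_true] at h6
            rw [h6] at hl'
            exact ⟨(hm' _ (by omega)).trans (hx hr).1, (hm' _ (by omega)).trans (hx hr).2, hl'⟩
          · rw [List.filter_cons_of_neg (by simpa using hr)]
            simp only [hr] at h6
            rw [h6] at hl'
            exact hl'
        · by_cases hr : r x.1 (s.rreg 3)
          · rw [List.filter_cons_of_pos (by simpa using hr), List.length_cons]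
            simp only [hr, if_true] at h6
            omega
          · rw [List.filter_cons_of_neg (by simpa using hr)]
            simp only [hr] at h6
            simpa [h6] using h6'
        · rw [hm' a (by omega), hm a ha]
    · simp only [List.length_cons]
      omega

/-- `s'` arises from `s` by writing a new list behind the current one. -/
structure ListStep (s s' : Config) : Prop where
  nreg : ∀ r, r = 0 ∨ r = 3 ∨ 10 ≤ r → s'.nreg r = s.nreg r
  rreg : ∀ r, r < 4 ∨ 10 ≤ r → s'.rreg r = s.rreg r
  nmem : s'.nmem = s.nmem
  lt : s.nreg 2 < s'.nreg 1
  rmem : ∀ a ≤ s.nreg 2, s'.rmem a = s.rmem a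

/-- Runs `pre` and `loop` from the start of the current list, with the writing pointer behind the
list, and makes the list that was written the current one. -/
def rewriteList (pre loop : Cmd) : Cmd :=
  .op (.natConst 7 1) ;; .op (.natAdd 4 2 7) ;; .op (.natCopy 5 1) ;; .op (.natCopy 6 4) ;;
  pre ;; loop ;; .op (.natCopy 1 4) ;; .op (.natCopy 2 6)

/-- Replaces the current list by the pairs that pass the test `t`. -/
def filterCmd (t : Test) : Cmd := rewriteList .skip (.loop (.natLt 5 2) (filterBody t))

/-- The new list starts one cell beyond the old end, so the cell directly behind the old list
survives as well. `medianPivot` keeps the level there while `mediansCmd`, which leaves the same gap,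
and the recursive call run. -/
theorem runs_filterCmd {procs : List Cmd} {t : Test} {r : ℝ → ℝ → Bool}
    (ht : ∀ s, t.Holds s ↔ r (s.rreg 5) (s.rreg 3)) {l : List (ℝ × ℝ)} {s : Config}
    (hs : s.HasList l) :
    Runs procs (filterCmd t) s (11 * l.length + 8) fun s' =>
      ListStep s s' ∧ s'.HasList (l.filter fun x => r x.1 (s.rreg 3)) := by
  refine Runs.mono (.op_seq <| .op_seq <| .op_seq <| .op_seq <|
    .seq (.skip rfl) fun s' hs' => .seq (runs_filter_loop ht l _ ?_ ?_ ?_)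
      fun s'' h => .op_seq <| .op ?_) (show _ ≤ _ from ?_) fun _ => id
  · subst hs'
    simpa [Op.apply, Function.update_apply] using hs.listAt
  · subst hs'
    simpa [Op.apply, Function.update_apply] using hs.finish
  · subst hs'
    simp [Op.apply]
  · subst hs'
    obtain ⟨⟨hn, hr, hm⟩, hl, h6, hmem⟩ := h
    have h4 := hn 4 (by omega)
    simp [Op.apply, Function.update_apply] at h4 hl h6 hmem hm hr hn
    refine ⟨⟨?_, ?_, ?_, ?_, ?_⟩, ?_, ?_⟩
    all_goals simp [Op.apply, Function.update_apply, h4, h6, hm]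
    · grind
    · exact hr
    · intro a ha
      exact hmem a (by omega)
    · exact hl
  · omega

/-! ### Computing medians of triples -/

/-- Replaces real register `6` by the median of real registers `5`, `6` and `7`. -/
def medianCmd : Cmd :=
  .branch (.realLt 6 5) (.op (.realCopy 4 5) ;; .op (.realCopy 5 6) ;; .op (.realCopy 6 4)) .skip ;;
  .branch (.realLt 7 6) (.op (.realCopy 6 7)) .skip ;;
  .branch (.realLt 6 5) (.op (.realCopy 6 5)) .skip

theorem runs_medianCmd {procs : List Cmd} (s : Config) :
    Runs procs medianCmd s 8 fun s' =>
      s'.rreg 6 = medianThree (s.rreg 5) (s.rreg 6) (s.rreg 7) ∧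
      (∀ r, r < 4 ∨ 7 ≤ r → s'.rreg r = s.rreg r) ∧
      s'.nreg = s.nreg ∧ s'.nmem = s.nmem ∧ s'.rmem = s.rmem := by
  -- The three branches evaluate `max (min a b) (min (max a b) c)`: sort the first two keys, cap the
  -- larger by the third, then take the maximum.
  refine Runs.mono (K := 4 + (2 + 2)) (.seq (R := fun s' =>
      s'.rreg 5 = min (s.rreg 5) (s.rreg 6) ∧ s'.rreg 6 = max (s.rreg 5) (s.rreg 6) ∧
      (∀ r, r < 4 ∨ 7 ≤ r → s'.rreg r = s.rreg r) ∧
      s'.nreg = s.nreg ∧ s'.nmem = s.nmem ∧ s'.rmem = s.rmem) ?_ fun s₁ h₁ =>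
    .seq (R := fun s' =>
      s'.rreg 5 = min (s.rreg 5) (s.rreg 6) ∧
      s'.rreg 6 = min (max (s.rreg 5) (s.rreg 6)) (s.rreg 7) ∧
      (∀ r, r < 4 ∨ 7 ≤ r → s'.rreg r = s.rreg r) ∧
      s'.nreg = s.nreg ∧ s'.nmem = s.nmem ∧ s'.rmem = s.rmem) ?_ fun s₂ h₂ => ?_)
    (by omega) fun _ => id
  · refine .branch (K := 3) (fun h => .op_seq <| .op_seq <| .op ?_)
      fun h => Runs.mono (.skip ?_) (show 1 ≤ 3 by omega) fun _ => id
    · have h' : s.rreg 6 < s.rreg 5 := h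
      simp [Op.apply, Function.update_apply, h'.le]
      grind
    · have h' : s.rreg 5 ≤ s.rreg 6 := not_lt.1 h
      simp [h']
  · obtain ⟨h5, h6, hr, hn, hnm, hrm⟩ := h₁
    have h7 := hr 7 (by omega)
    refine .branch (K := 1) (fun h => .op ?_) fun h => .skip ?_
    · have h' : s₁.rreg 7 < s₁.rreg 6 := h
      rw [h6, h7] at h'
      simp only [Op.apply, hn, hnm, hrm, and_self, and_true, min_eq_right h'.le]
      simp [Function.update_apply, h5, h7]
      grind
    · have h' : s₁.rreg 6 ≤ s₁.rreg 7 := not_lt.1 h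
      rw [h6, h7] at h'
      exact ⟨h5, by rw [h6, min_eq_left h'], hr, hn, hnm, hrm⟩
  · obtain ⟨h5, h6, hr, hn, hnm, hrm⟩ := h₂
    refine .branch (K := 1) (fun h => .op ?_) fun h => .skip ?_
    · have h' : s₂.rreg 6 < s₂.rreg 5 := h
      rw [h5, h6] at h'
      simp only [Op.apply, hn, hnm, hrm, and_self, and_true, medianThree, max_eq_left h'.le]
      simp [Function.update_apply, h5]
      grind
    · have h' : s₂.rreg 5 ≤ s₂.rreg 6 := not_lt.1 h
      rw [h5, h6] at h'
      exact ⟨by rw [h6, medianThree, max_eq_right h'], hr, hn, hnm, hrm⟩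

/-- Reads three pairs and writes the median of their keys with weight `1`. -/
def mediansBody : Cmd :=
  .op (.natConst 8 2) ;; .op (.realLoad 5 5) ;; .op (.natAdd 5 5 8) ;; .op (.realLoad 6 5) ;;
  .op (.natAdd 5 5 8) ;; .op (.realLoad 7 5) ;; .op (.natAdd 5 5 8) ;; medianCmd ;;
  .op (.natConst 7 1) ;; .op (.realStore 6 6) ;; .op (.natAdd 6 6 7) ;; .op (.realStore 6 9) ;;
  .op (.natAdd 6 6 7) ;; .op (.realAdd 8 8 9) ;; .op (.natConst 7 6) ;; .op (.natAdd 9 5 7)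

theorem runs_mediansBody {procs : List Cmd} {s : Config} {x y z : ℝ × ℝ} {l : List (ℝ × ℝ)}
    (hl : ListAt s.rmem (s.nreg 5) (x :: y :: z :: l)) (h9 : s.rreg 9 = 1) :
    Runs procs mediansBody s 23 fun s' =>
      ScratchOnly s s' ∧ s'.nreg 5 = s.nreg 5 + 6 ∧ s'.nreg 6 = s.nreg 6 + 2 ∧
      s'.nreg 9 = s.nreg 5 + 12 ∧ s'.rreg 9 = 1 ∧ s'.rreg 8 = s.rreg 8 + 1 ∧
      s'.rmem (s.nreg 6) = medianThree x.1 y.1 z.1 ∧ s'.rmem (s.nreg 6 + 1) = 1 ∧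
      ∀ a < s.nreg 6, s'.rmem a = s.rmem a := by
  obtain ⟨hx, -, hy, -, hz, -, -⟩ := hl
  refine Runs.mono (.op_seq <| .op_seq <| .op_seq <| .op_seq <| .op_seq <| .op_seq <| .op_seq <|
    .seq (runs_medianCmd _) fun s' h => .op_seq <| .op_seq <| .op_seq <| .op_seq <| .op_seq <|
    .op_seq <| .op_seq <| .op ?_) (by omega) fun _ => id
  obtain ⟨h6, hr, hn, hnm, hrm⟩ := h
  have h8 := hr 8 (by omega)
  have h9' := hr 9 (by omega)
  simp [Op.apply, Function.update_apply, hx, hy, hz, h9, add_assoc] at h6 hr h8 h9' hn hnm hrm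
  refine ⟨⟨?_, ?_, ?_⟩, ?_⟩
  · simp [Op.apply, Function.update_apply, hn]
    grind
  · simp [Op.apply, Function.update_apply]
    grind
  · simp [Op.apply, hnm]
  · simp [Op.apply, Function.update_apply, hn, h6, h8, h9', hrm]
    grind

/-- Natural-number register `9` stays six cells ahead of the reading pointer, so the loop test asks
whether a whole triple remains. The medians are counted in a real register because half their number
is the next level, and no operation converts naturals to reals. -/
theorem runs_medians_loop {procs : List Cmd} : ∀ (l : List (ℝ × ℝ)) (s : Config),
    ListAt s.rmem (s.nreg 5) l → s.nreg 2 = s.nreg 5 + 2 * l.length → s.nreg 2 < s.nreg 6 →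
    s.nreg 9 = s.nreg 5 + 6 → s.rreg 9 = 1 →
    Runs procs (.loop (.natLe 9 2) mediansBody) s (24 * l.length + 1) fun s' =>
      ScratchOnly s s' ∧ ListAt s'.rmem (s.nreg 6) (medians l) ∧
      s'.nreg 6 = s.nreg 6 + 2 * (medians l).length ∧
      s'.rreg 8 = s.rreg 8 + (medians l).length ∧ ∀ a < s.nreg 6, s'.rmem a = s.rmem a
  | x :: y :: z :: l, s, hl, hs, hj, h9, hr9 => by
    simp only [List.length_cons] at hs
    refine (Runs.loop_true (by simp only [Test.Holds]; omega) (runs_mediansBody hl hr9)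
      (L := 24 * l.length + 1) ?_).mono (by simp only [List.length_cons]; omega) fun _ => id
    rintro s' ⟨hf, h5', h6', h9', hr9', hr8', hm₁, hm₂, hm⟩
    have h2 := hf.nreg 2 (by omega)
    refine (runs_medians_loop l s' ?_ (by omega) (by omega) (by omega) hr9').mono le_rfl ?_
    · rw [h5']
      exact hl.2.2.2.2.2.2.congr fun i _ hi => hm i (by omega)
    · rintro s'' ⟨hf', hl', h6'', h8'', hm'⟩
      rw [h6'] at hl'
      refine ⟨hf.trans hf', ⟨?_, ?_, hl'⟩, ?_, ?_, fun a ha => ?_⟩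
      · rw [hm' _ (by omega), hm₁]
      · rw [hm' _ (by omega), hm₂]
      · simp only [medians, List.length_cons]
        omega
      · simp only [medians, List.length_cons]
        push_cast
        linarith
      · rw [hm' a (by omega), hm a ha]
  | [], s, hl, hs, hj, h9, hr9 | [_], s, hl, hs, hj, h9, hr9 | [_, _], s, hl, hs, hj, h9, hr9 => by
    simp only [List.length_cons, List.length_nil] at hs
    refine Runs.mono (.loop_false (by simp only [Test.Holds]; omega)
      ⟨.refl s, trivial, rfl, by simp [medians], fun _ _ => rfl⟩) (by omega) fun _ => id

/-- Replaces the current list by the medians of its triples; real register `8` counts them. -/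
def mediansCmd : Cmd :=
  rewriteList (.op (.natConst 7 6) ;; .op (.natAdd 9 5 7) ;; .op (.realConst 8 0) ;;
    .op (.realConst 9 1)) (.loop (.natLe 9 2) mediansBody)

theorem runs_mediansCmd {procs : List Cmd} {l : List (ℝ × ℝ)} {s : Config} (hs : s.HasList l) :
    Runs procs mediansCmd s (24 * l.length + 11) fun s' =>
      ListStep s s' ∧ s'.HasList (medians l) ∧ s'.rreg 8 = (medians l).length := by
  refine Runs.mono (.op_seq <| .op_seq <| .op_seq <| .op_seq <|
    .seq (.op_seq <| .op_seq <| .op_seq <| .op rfl) fun s' hs' => .seq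
      (runs_medians_loop l _ ?_ ?_ ?_ ?_ ?_)
      fun s'' h => .op_seq <| .op ?_) (show _ ≤ _ from ?_) fun _ => id
  iterate 5
    subst hs'
    simp [Op.apply, hs.listAt, hs.finish]
  · subst hs'
    obtain ⟨⟨hn, hr, hm⟩, hl, h6, h8, hmem⟩ := h
    have h4 := hn 4 (by omega)
    simp [Op.apply, Function.update_apply] at h4 hl h6 h8 hmem hm hr hn
    refine ⟨⟨?_, ?_, ?_, ?_, ?_⟩, ⟨?_, ?_⟩, ?_⟩
    all_goals simp [Op.apply, Function.update_apply, h4, h6, hm]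
    · grind
    · grind
    · intro a ha
      exact hmem a (by omega)
    · exact hl
    · exact h8
  · omega

/-! ### Masses below and at the pivot -/

/-- Adds up, in real registers `8` and `9`, the weights of the keys of the current list that are
below and equal to real register `3`. -/
def weightsCmd : Cmd :=
  .op (.natConst 7 1) ;; .op (.natCopy 5 1) ;; .op (.realConst 8 0) ;; .op (.realConst 9 0) ;;
  .loop (.natLt 5 2) (
    .op (.realLoad 5 5) ;; .op (.natAdd 5 5 7) ;; .op (.realLoad 6 5) ;; .op (.natAdd 5 5 7) ;;
    .branch (.realLt 5 3) (.op (.realAdd 8 8 6))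
      (.branch (.realLe 5 3) (.op (.realAdd 9 9 6)) .skip))

theorem runs_weights_loop {procs : List Cmd} (l : List (ℝ × ℝ)) :
    ∀ s : Config, ListAt s.rmem (s.nreg 5) l → s.nreg 2 = s.nreg 5 + 2 * l.length →
      s.nreg 7 = 1 →
      Runs procs (.loop (.natLt 5 2) (
        .op (.realLoad 5 5) ;; .op (.natAdd 5 5 7) ;; .op (.realLoad 6 5) ;;
        .op (.natAdd 5 5 7) ;; .branch (.realLt 5 3) (.op (.realAdd 8 8 6))
          (.branch (.realLe 5 3) (.op (.realAdd 9 9 6)) .skip))) s (8 * l.length + 1) fun s' =>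
        ScratchOnly s s' ∧ s'.rreg 8 = s.rreg 8 + weightLt (s.rreg 3) l ∧
        s'.rreg 9 = s.rreg 9 + weightEq (s.rreg 3) l ∧ s'.rmem = s.rmem := by
  induction l with
  | nil =>
    intro s hl hs h7
    refine Runs.loop_false ?_ ⟨.refl s, by simp [weightLt], by simp [weightEq], rfl⟩
    simp at hs
    simp [Test.Holds, hs]
  | cons x l ih =>
    intro s hl hs h7
    obtain ⟨h₁, h₂, h₃⟩ := hl
    simp only [List.length_cons] at hs
    refine (Runs.loop_true (K := 7) (L := 8 * l.length + 1) (R := fun s' =>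
      ScratchOnly s s' ∧ s'.nreg 5 = s.nreg 5 + 2 ∧ s'.nreg 7 = 1 ∧
      s'.rreg 8 = s.rreg 8 + (if x.1 < s.rreg 3 then x.2 else 0) ∧
      s'.rreg 9 = s.rreg 9 + (if x.1 = s.rreg 3 then x.2 else 0) ∧
      s'.rmem = s.rmem) ?_ ?_ ?_).mono ?_ fun _ => id
    · simp only [Test.Holds]
      omega
    · refine .op_seq <| .op_seq <| .op_seq <| .op_seq <| .branch (K := 2) (fun h => ?_) fun h =>
        .branch (fun h' => .op ?_) fun h' => .skip ?_
      · refine Runs.mono (.op ?_) (show 1 ≤ 2 by omega) fun _ => id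
        simp [Test.Holds, Op.apply, h₁, h7] at h
        refine ⟨⟨?_, ?_, ?_⟩, ?_⟩
        all_goals simp [Op.apply, Function.update_apply, h₁, h₂, h7, h, h.ne]
        all_goals grind
      · simp [Test.Holds, Op.apply, h₁, h7] at h h'
        have heq := le_antisymm h' h
        refine ⟨⟨?_, ?_, ?_⟩, ?_⟩
        all_goals simp [Op.apply, Function.update_apply, h₁, h₂, h7, heq]
        all_goals grind
      · simp [Test.Holds, Op.apply, h₁, h7] at h h'
        refine ⟨⟨?_, ?_, ?_⟩, ?_⟩
        all_goals simp [Op.apply, Function.update_apply, h₁, h7, h.not_gt, h'.ne']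
        all_goals grind
    · rintro s' ⟨hf, h5, h7', h8, h9, hm⟩
      have h2 := hf.nreg 2 (by omega)
      have hθ := hf.rreg 3 (by omega)
      refine (ih s' (by rwa [h5, hm]) (by omega) h7').mono le_rfl ?_
      rintro s'' ⟨hf', h8', h9', hm'⟩
      refine ⟨hf.trans hf', ?_, ?_, hm'.trans hm⟩
      · rw [h8', h8, hθ]
        simp [weightLt, add_assoc]
      · rw [h9', h9, hθ]
        simp [weightEq, add_assoc]
    · simp only [List.length_cons]
      omega

theorem runs_weightsCmd {procs : List Cmd} {l : List (ℝ × ℝ)} {s : Config} (hs : s.HasList l) :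
    Runs procs weightsCmd s (8 * l.length + 5) fun s' =>
      ScratchOnly s s' ∧ s'.rreg 8 = weightLt (s.rreg 3) l ∧
      s'.rreg 9 = weightEq (s.rreg 3) l ∧ s'.rmem = s.rmem := by
  refine Runs.mono (.op_seq <| .op_seq <| .op_seq <| .op_seq <| runs_weights_loop l _ ?_ ?_ ?_)
    (by omega) ?_
  iterate 3 simp [Op.apply, hs.listAt, hs.finish]
  rintro s' ⟨⟨hn, hr, hm⟩, h8, h9, hmem⟩
  simp [Op.apply, Function.update_apply] at hn hr hm h8 h9 hmem
  refine ⟨⟨?_, ?_, hm⟩, h8, h9, hmem⟩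
  · grind
  · grind

/-! ### The selection procedure -/

/-- Computes the pivot of a long list: saves the list and the level, selects the median of the
medians of medians by a recursive call, and restores what was saved. -/
def medianPivot : Cmd :=
  .op (.realStore 2 2) ;; .op (.natConst 7 1) ;; .op (.natStore 3 1) ;; .op (.natAdd 3 3 7) ;;
  .op (.natStore 3 2) ;; .op (.natAdd 3 3 7) ;; mediansCmd ;; mediansCmd ;;
  .op (.realConst 9 2) ;; .op (.realDiv 2 8 9) ;; .call 0 ;;
  .op (.natConst 7 1) ;; .op (.natSub 3 3 7) ;; .op (.natLoad 2 3) ;; .op (.natSub 3 3 7) ;;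
  .op (.natLoad 1 3) ;; .op (.realLoad 2 2)

/-- Chooses a pivot; lists with fewer than nine pairs are split at the first key. -/
def pivotCmd : Cmd :=
  .op (.natConst 7 18) ;; .op (.natAdd 7 1 7) ;;
  .branch (.natLt 2 7) (.op (.realLoad 3 1)) medianPivot

/-- Splits the current list at the pivot and continues in the part that contains the quantile. -/
def splitCmd : Cmd :=
  weightsCmd ;;
  .branch (.realLt 2 8) (filterCmd (.realLt 5 3) ;; .call 0)
    (.op (.realSub 2 2 8) ;;
      .branch (.realLt 2 9) (.op (.realCopy 4 2))
        (.op (.realSub 2 2 9) ;; filterCmd (.realLt 3 5) ;; .call 0))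

/-- Weighted selection: finds the quantile of the current list at the level in real
register `2`. -/
def selectCmd : Cmd := pivotCmd ;; splitCmd

/-- The effect of the selection procedure on the list `l`. -/
structure Selected (l : List (ℝ × ℝ)) (s s' : Config) : Prop where
  nreg : ∀ r, r = 0 ∨ r = 3 ∨ 10 ≤ r → s'.nreg r = s.nreg r
  rreg : ∀ r, r < 2 ∨ 10 ≤ r → s'.rreg r = s.rreg r
  nmem : ∀ a < s.nreg 3, s'.nmem a = s.nmem a
  rmem : ∀ a < s.nreg 1, s'.rmem a = s.rmem a
  quantile : IsQuantile l (s.rreg 2) (s'.rreg 3) (s'.rreg 4)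

/-- The effect of choosing a pivot: the list and the level are kept, and each part has at least `d`
pairs less than `l`. -/
structure PivotChosen (l : List (ℝ × ℝ)) (d : ℕ) (s s' : Config) : Prop where
  nreg : ∀ r, r < 4 ∨ 10 ≤ r → s'.nreg r = s.nreg r
  rreg : ∀ r, r < 3 ∨ 10 ≤ r → s'.rreg r = s.rreg r
  nmem : ∀ a < s.nreg 3, s'.nmem a = s.nmem a
  rmem : ∀ a < s.nreg 2, s'.rmem a = s.rmem a
  lt : (l.filter fun x => decide (x.1 < s'.rreg 3)).length + d ≤ l.length
  gt : (l.filter fun x => decide (s'.rreg 3 < x.1)).length + d ≤ l.length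

/-- Calls of the selection procedure on lists with fewer than `m` pairs run in linear time. -/
def SelectsBelow (procs : List Cmd) (A m : ℕ) : Prop :=
  ∀ (l : List (ℝ × ℝ)) (s : Config), l.length < m → s.HasList l → 0 ≤ s.rreg 2 →
    s.rreg 2 < weight l → Runs procs (.call 0) s (A * l.length) (Selected l s)

theorem weight_medians (l : List (ℝ × ℝ)) : weight (medians l) = (medians l).length := by
  unfold weight
  rw [List.map_congr_left (g := fun _ => 1) fun x hx => snd_eq_one_of_mem_medians hx]
  simp

theorem ListStep.listAt {s s' : Config} {l : List (ℝ × ℝ)} (h : ListStep s s')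
    (hs : s.HasList l) : ListAt s'.rmem (s.nreg 1) l :=
  hs.listAt.congr fun i _ hi => h.rmem i (by have := hs.finish; omega)

/-- The recursive call respects the natural-number memory below its stack pointer and the real
memory before its own list. Hence the saved bounds, the saved level and the original list are all
intact afterwards. -/
theorem runs_medianPivot {procs : List Cmd} {A : ℕ} {l : List (ℝ × ℝ)} {s : Config}
    (hs : s.HasList l) (hl : 9 ≤ l.length) (hA : SelectsBelow procs A l.length) :
    Runs procs medianPivot s (32 * l.length + 50 + A * (l.length / 9))
      (PivotChosen l (2 * (l.length / 9)) s) := by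
  have hlen : (medians (medians l)).length = l.length / 9 := by
    rw [length_medians, length_medians, Nat.div_div_eq_div_mul]
  have hlen' := length_medians l
  have hfinish := hs.finish
  refine Runs.mono (.op_seq <| .op_seq <| .op_seq <| .op_seq <| .op_seq <| .op_seq <|
    .seq (runs_mediansCmd (l := l) ⟨?_, ?_⟩) fun s₁ h₁ => .seq (runs_mediansCmd h₁.2.1)
      fun s₂ h₂ => .op_seq <| .op_seq <| .seq (hA (medians (medians l)) _ (by omega) ⟨?_, ?_⟩ ?_ ?_)
      fun s₃ h₃ => .op_seq <| .op_seq <| .op_seq <| .op_seq <| .op_seq <| .op ?_)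
    (show _ ≤ _ from ?_) fun _ => id
  · simp [Op.apply]
    refine hs.listAt.congr fun i _ hi => ?_
    have : i ≠ s.nreg 2 := by omega
    simp [this]
  · simpa [Op.apply, Function.update_apply] using hs.finish
  · simpa [Op.apply] using h₂.2.1.listAt
  · simpa [Op.apply] using h₂.2.1.finish
  · simp [Op.apply, h₂.2.2]
    positivity
  -- Half the number of medians is a legal level only if that number is positive, hence the
  -- requirement of nine pairs.
  · simp [Op.apply, h₂.2.2, weight_medians, hlen]
    omega
  · obtain ⟨h₁, hl₁, -⟩ := h₁
    obtain ⟨h₂, hl₂, h8⟩ := h₂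
    obtain ⟨hn₁, hr₁, hnm₁, hlt₁, hrm₁⟩ := h₁
    obtain ⟨hn₂, hr₂, hnm₂, hlt₂, hrm₂⟩ := h₂
    obtain ⟨hn₃, hr₃, hnm₃, hrm₃, hq⟩ := h₃
    have e₁ := hl₁.finish
    have sp₁ := hn₁ 3 (by omega)
    have sp₂ := hn₂ 3 (by omega)
    have sp₃ := hn₃ 3 (by omega)
    simp [Op.apply, Function.update_apply] at hn₁ hr₁ hnm₁ hlt₁ hrm₁ sp₁
    simp [Op.apply, Function.update_apply, sp₂, sp₁] at hn₃ hr₃ hnm₃ hrm₃ hq sp₃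
    have hbound := IsQuantile.length_filter_le (l := l) (θ := s₃.rreg 3) (R := s₃.rreg 4)
      (by rwa [h8, hlen] at hq)
    have hs₀ : s₃.nmem (s.nreg 3) = s.nreg 1 := by
      rw [hnm₃ _ (by omega), hnm₂, hnm₁]
      simp
    have hs₁ : s₃.nmem (s.nreg 3 + 1) = s.nreg 2 := by
      rw [hnm₃ _ (by omega), hnm₂, hnm₁]
      simp
    have hτ : s₃.rmem (s.nreg 2) = s.rreg 2 := by
      rw [hrm₃ _ (by omega), hrm₂ _ (by omega), hrm₁ _ le_rfl]
      simp
    refine ⟨?_, ?_, ?_, ?_, ?_, ?_⟩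
    · simp [Op.apply, Function.update_apply, sp₃, hs₀, hs₁]
      grind
    · simp [Op.apply, Function.update_apply, sp₃, hs₁, hτ]
      grind
    · intro a ha
      simp [Op.apply]
      rw [hnm₃ _ (by omega), hnm₂, hnm₁]
      grind
    · intro a ha
      simp [Op.apply]
      rw [hrm₃ _ (by omega), hrm₂ _ (by omega), hrm₁ _ (by omega)]
      grind
    · simpa [Op.apply] using hbound.1
    · simpa [Op.apply] using hbound.2
  -- The two rounds of medians cost `24 * n + 24 * (n / 3) ≤ 32 * n`, up to constants.
  · rw [hlen, hlen']
    omega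

/-- The `1` in the maximum is for short lists: there the pivot is the first key, which belongs to
neither strict part. Long lists lose two ninths on either side. -/
theorem runs_pivotCmd {procs : List Cmd} {A : ℕ} {l : List (ℝ × ℝ)} {s : Config}
    (hs : s.HasList l) (hl : l ≠ []) (hA : SelectsBelow procs A l.length) :
    Runs procs pivotCmd s (32 * l.length + 53 + A * (l.length / 9))
      (PivotChosen l (max 1 (2 * (l.length / 9))) s) := by
  have hfinish := hs.finish
  refine Runs.mono (K := 32 * l.length + 50 + A * (l.length / 9) + 1 + 1 + 1)
    (.op_seq <| .op_seq <| .branch (fun h => ?_) fun h => ?_) (by omega) fun _ => id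
  · simp [Test.Holds, Op.apply] at h
    have h9 : l.length / 9 = 0 := by omega
    refine Runs.mono (.op ?_) (show 1 ≤ _ by omega) fun _ => id
    obtain ⟨x, l, rfl⟩ := List.exists_cons_of_ne_nil hl
    have hx := hs.listAt.1
    rw [h9]
    refine ⟨?_, ?_, ?_, ?_, ?_, ?_⟩
    all_goals simp [Op.apply, Function.update_apply, hx]
    · grind
    · grind
    · exact List.length_filter_le _ _
    · exact List.length_filter_le _ _
  · simp [Test.Holds, Op.apply] at h
    have hl' : 9 ≤ l.length := by omega
    refine (runs_medianPivot (l := l) ⟨?_, ?_⟩ hl' hA).mono le_rfl fun s' h => ?_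
    · simpa [Op.apply] using hs.listAt
    · simpa [Op.apply] using hs.finish
    · obtain ⟨hn, hr, hnm, hrm, hlt, hgt⟩ := h
      simp [Op.apply, Function.update_apply] at hn hr hnm hrm
      rw [max_eq_right (by omega)]
      refine ⟨?_, hr, hnm, hrm, hlt, hgt⟩
      grind

/-- Common to both recursive branches: the part is written behind the list, so the call on it leaves
everything before the list alone. Only the transfer `hq` of the quantile depends on the side. -/
theorem Selected.of_part {l l' : List (ℝ × ℝ)} {s s₁ s₂ s₃ : Config} (h : Selected l' s₂ s₃)
    (h₂ : ListStep s₁ s₂) (hn : ∀ r, r < 4 ∨ 10 ≤ r → s₁.nreg r = s.nreg r)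
    (hr : ∀ r, r < 2 ∨ 10 ≤ r → s₁.rreg r = s.rreg r)
    (hnm : ∀ a < s.nreg 3, s₁.nmem a = s.nmem a) (hrm : ∀ a < s.nreg 1, s₁.rmem a = s.rmem a)
    (hle : s.nreg 1 ≤ s.nreg 2)
    (hq : ∀ θ R, IsQuantile l' (s₁.rreg 2) θ R → IsQuantile l (s.rreg 2) θ R) :
    Selected l s s₃ where
  nreg r hr' := by rw [h.nreg r hr', h₂.nreg r hr', hn r (by omega)]
  rreg r hr' := by rw [h.rreg r hr', h₂.rreg r (by omega), hr r hr']
  nmem a ha := by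
    have := h₂.nreg 3 (by omega)
    have := hn 3 (by omega)
    rw [h.nmem a (by omega), h₂.nmem, hnm a ha]
  rmem a ha := by
    have := h₂.lt
    have := hn 2 (by omega)
    rw [h.rmem a (by omega), h₂.rmem a (by omega), hrm a ha]
  quantile := hq _ _ (by
    rw [← h₂.rreg 2 (by omega)]
    exact h.quantile)

/-- With `L` and `E` the masses below and at the pivot, a level `τ < L` continues below, `L ≤ τ < L
+ E` makes the pivot the quantile with room `τ - L`, and otherwise the search continues above at
level `τ - L - E`. Each choice maintains `0 ≤ level < weight`, and `0 < d` makes both parts strictly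
shorter. -/
theorem runs_splitCmd {procs : List Cmd} {A d : ℕ} {l : List (ℝ × ℝ)} {s s₁ : Config}
    (hs : s.HasList l) (h₀ : 0 ≤ s.rreg 2) (hτ : s.rreg 2 < weight l)
    (hA : SelectsBelow procs A l.length) (hd : 0 < d) (h : PivotChosen l d s s₁) :
    Runs procs splitCmd s₁ (19 * l.length + 20 + A * (l.length - d)) (Selected l s) := by
  have hfinish := hs.finish
  have h1 := h.nreg 1 (by omega)
  have h2 := h.nreg 2 (by omega)
  have h3 := h.nreg 3 (by omega)
  have hl : s₁.HasList l := by
    refine ⟨?_, by omega⟩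
    rw [h1]
    exact hs.listAt.congr fun i _ hi => h.rmem i (by omega)
  have hτ₁ := h.rreg 2 (by omega)
  refine Runs.mono (K := (8 * l.length + 5) + (11 * l.length + 12 + A * (l.length - d) + 1))
    (.seq (runs_weightsCmd hl) fun s₂ h₂ => ?_) (by omega) fun _ => id
  obtain ⟨h₂, h8, h9, hm⟩ := h₂
  have h1₂ := h₂.nreg 1 (by omega)
  have h2₂ := h₂.nreg 2 (by omega)
  have h3₂ := h₂.nreg 3 (by omega)
  have hl₂ : s₂.HasList l := ⟨by rw [h1₂, hm]; exact hl.listAt, by rw [h1₂, h2₂]; exact hl.finish⟩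
  have hτ₂ : s₂.rreg 2 = s.rreg 2 := (h₂.rreg 2 (by omega)).trans hτ₁
  have hθ₂ := h₂.rreg 3 (by omega)
  have hlt := h.lt
  have hgt := h.gt
  rw [← hθ₂] at h8 h9 hlt hgt
  have hnm : ∀ a < s.nreg 3, s₂.nmem a = s.nmem a := fun a ha => by rw [h₂.nmem, h.nmem a ha]
  have hrm : ∀ a < s.nreg 1, s₂.rmem a = s.rmem a := fun a ha => by
    rw [hm, h.rmem a (by omega)]
  have hn : ∀ r, r < 4 ∨ 10 ≤ r → s₂.nreg r = s.nreg r := fun r hr => by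
    rw [h₂.nreg r (by omega), h.nreg r hr]
  have hr : ∀ r, r < 3 ∨ 10 ≤ r → s₂.rreg r = s.rreg r := fun r hr => by
    rw [h₂.rreg r (by omega), h.rreg r hr]
  have hcost : ∀ k, k + d ≤ l.length → A * k ≤ A * (l.length - d) := fun k hk =>
    Nat.mul_le_mul_left A (by omega)
  refine .branch (fun ht => ?_) fun ht => ?_
  · simp only [Test.Holds, h8, hτ₂] at ht
    refine Runs.mono (.seq (runs_filterCmd (r := fun a b => decide (a < b))
      (fun s => by simp [Test.Holds]) hl₂) fun s₃ h₃ => Runs.mono (hA _ s₃ (by omega) h₃.2 ?_ ?_)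
        (hcost _ hlt) fun s₄ h₄ => ?_) (by omega) fun _ => id
    · rw [h₃.1.rreg 2 (by omega), hτ₂]
      exact h₀
    · rw [h₃.1.rreg 2 (by omega), hτ₂, weight_filter_lt]
      exact ht
    · refine h₄.of_part h₃.1 hn (fun r h => hr r (by omega)) hnm hrm (by omega) fun θ R hq => ?_
      rw [← hτ₂]
      exact hq.of_filter_lt
  · simp only [Test.Holds, h8, hτ₂, not_lt] at ht
    have hτ₃ : (Op.apply s₂ (.realSub 2 2 8)).rreg 2 = s.rreg 2 - weightLt (s₂.rreg 3) l := by
      simp [Op.apply, hτ₂, h8]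
    refine Runs.mono (K := 11 * l.length + 9 + A * (l.length - d) + 1 + 1)
      (.op_seq <| .branch (fun ht' => Runs.mono (.op ?_) (show 1 ≤ _ by omega) fun _ => id)
        fun ht' => Runs.mono (.op_seq (.seq (runs_filterCmd (r := fun a b => decide (b < a))
          (l := l) (fun s => by simp [Test.Holds]) ⟨?_, ?_⟩)
          fun s₃ h₃ => Runs.mono (hA _ s₃ (lt_of_lt_of_le (lt_add_of_pos_right _ hd) hgt) h₃.2 ?_ ?_)
            (hcost _ (by exact hgt)) fun s₄ h₄ => ?_)) (by omega) fun _ => id)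
      (by omega) fun _ => id
    · simp only [Test.Holds, hτ₃] at ht'
      simp [Op.apply, h9] at ht'
      refine ⟨?_, ?_, ?_, ?_, ⟨?_, ?_, ?_⟩⟩
      all_goals simp [Op.apply, Function.update_apply, hτ₂, h8]
      · grind
      · grind
      · exact hnm
      · exact hrm
      · exact ht
      · exact ht'
    · simpa [Op.apply] using hl₂.listAt
    · simpa [Op.apply] using hl₂.finish
    · rw [h₃.1.rreg 2 (by omega)]
      simp only [Test.Holds, hτ₃, not_lt] at ht'
      simp [Op.apply, h9] at ht'
      simp [Op.apply, hτ₂, h8, h9]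
      exact ht'
    · rw [h₃.1.rreg 2 (by omega)]
      simp [Op.apply, hτ₂, h8, h9, weight_filter_gt]
      exact hτ
    · refine h₄.of_part h₃.1 ?_ ?_ ?_ ?_ (by omega) fun θ R hq => ?_
      · simpa [Op.apply] using hn
      · simp [Op.apply, Function.update_apply]
        grind
      · simpa [Op.apply] using hnm
      · simpa [Op.apply] using hrm
      · refine IsQuantile.of_filter_gt (θ := s₂.rreg 3) ?_
        simpa [Op.apply, Function.update_apply, hτ₂, h8, h9] using hq

/-- The selection procedure runs in linear time. -/
theorem runs_select {procs : List Cmd} (hp : procs[0]? = some selectCmd) (m : ℕ) :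
    SelectsBelow procs 1000 m := by
  induction m with
  | zero => exact fun l s h => absurd h (Nat.not_lt_zero _)
  | succ m ih =>
    intro l s hm hs h₀ hτ
    have hA : SelectsBelow procs 1000 l.length := fun l' s' h => ih l' s' (by omega)
    have hl : l ≠ [] := by
      rintro rfl
      simp [weight] at hτ
      linarith
    have hpos := List.length_pos_iff.2 hl
    -- With `q = n / 9` rounded down, the work outside the recursive calls is at most `51 * n + 74`,
    -- and the calls cost `1000 * q + 1000 * (n - max 1 (2 * q))`. The saving is `1000` if `n ≤ 8`,
    -- and `1000 * q` otherwise, where `n ≤ 9 * q + 8`; both pay for the remaining work.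
    refine (Runs.call hp (.seq (runs_pivotCmd hs hl hA) fun s₁ h₁ =>
      runs_splitCmd hs h₀ hτ hA (by omega) h₁)).mono (by omega) fun _ => id

/-! ### Sizes of items -/

/-- The data of the items, indexed by natural numbers. -/
structure Table where
  /-- profits -/
  p : ℕ → ℝ
  /-- original weights -/
  w : ℕ → ℝ
  /-- improved weights -/
  v : ℕ → ℝ
  /-- improvement costs -/
  c : ℕ → ℝ
  /-- knapsack budget -/
  B : ℝ
  /-- improvement budget -/
  C : ℝ

namespace Table

variable (D : Table)

/-- The smaller of the sizes `w / B` and `v / B + c / C` of an item, among those for which the item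
alone is feasible, and whether the item is improved for it. The size is `-1` if there is none or if
the profit is not positive. -/
noncomputable def choice (k : ℕ) : ℝ × ℕ :=
  if 0 < D.p k then
    if D.v k ≤ D.B ∧ D.c k ≤ D.C ∧ ((if D.w k ≤ D.B then D.w k / D.B else -1) < 0 ∨
        D.v k / D.B + D.c k / D.C < if D.w k ≤ D.B then D.w k / D.B else -1) then
      (D.v k / D.B + D.c k / D.C, 1)
    else (if D.w k ≤ D.B then D.w k / D.B else -1, 0)
  else (-1, 0)

/-- The size of an item. -/
noncomputable def size (k : ℕ) : ℝ := (D.choice k).1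

/-- The size of an item per unit of profit. -/
noncomputable def key (k : ℕ) : ℝ := D.size k / D.p k

/-- The data are those of an instance. -/
structure Valid : Prop where
  v_nonneg : ∀ k, 0 ≤ D.v k
  v_le : ∀ k, D.v k ≤ D.w k
  c_nonneg : ∀ k, 0 ≤ D.c k
  B_nonneg : 0 ≤ D.B
  C_nonneg : 0 ≤ D.C

variable {D}

theorem cases_of_size_nonneg {k : ℕ} (h : 0 ≤ D.size k) :
    0 < D.p k ∧ ((D.choice k).2 = 0 ∧ D.w k ≤ D.B ∧ D.size k = D.w k / D.B ∨
      (D.choice k).2 = 1 ∧ D.v k ≤ D.B ∧ D.c k ≤ D.C ∧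
        D.size k = D.v k / D.B + D.c k / D.C) := by
  unfold size at h ⊢
  unfold choice at h ⊢
  by_cases hp : 0 < D.p k
  · rw [if_pos hp] at h ⊢
    refine ⟨hp, ?_⟩
    split_ifs at h ⊢ with hw h₁ h₁
    · exact Or.inr ⟨rfl, h₁.1, h₁.2.1, rfl⟩
    · exact Or.inl ⟨rfl, hw, rfl⟩
    · exact Or.inr ⟨rfl, h₁.1, h₁.2.1, rfl⟩
    · norm_num at h
  · rw [if_neg hp] at h
    norm_num at h

/-- The size is a minimum over the admissible modes. Validity makes both candidates nonnegative, so
the test `< 0` in `choice` recognizes only the sentinel `-1`. -/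
theorem Valid.size_le_of_w_le (hD : D.Valid) {k : ℕ} (hp : 0 < D.p k) (hw : D.w k ≤ D.B) :
    0 ≤ D.size k ∧ D.size k ≤ D.w k / D.B := by
  have h₁ : 0 ≤ D.w k / D.B := div_nonneg ((hD.v_nonneg k).trans (hD.v_le k)) hD.B_nonneg
  have h₂ : 0 ≤ D.v k / D.B + D.c k / D.C :=
    add_nonneg (div_nonneg (hD.v_nonneg k) hD.B_nonneg) (div_nonneg (hD.c_nonneg k) hD.C_nonneg)
  unfold size choice
  rw [if_pos hp]
  simp only [if_pos hw]
  split_ifs with h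
  · exact ⟨h₂, by rcases h.2.2 with h | h <;> linarith⟩
  · exact ⟨h₁, le_rfl⟩

theorem Valid.size_le_of_v_le (hD : D.Valid) {k : ℕ} (hp : 0 < D.p k) (hv : D.v k ≤ D.B)
    (hc : D.c k ≤ D.C) : 0 ≤ D.size k ∧ D.size k ≤ D.v k / D.B + D.c k / D.C := by
  have h₁ : D.w k ≤ D.B → 0 ≤ D.w k / D.B := fun _ =>
    div_nonneg ((hD.v_nonneg k).trans (hD.v_le k)) hD.B_nonneg
  have h₂ : 0 ≤ D.v k / D.B + D.c k / D.C :=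
    add_nonneg (div_nonneg (hD.v_nonneg k) hD.B_nonneg) (div_nonneg (hD.c_nonneg k) hD.C_nonneg)
  unfold size choice
  rw [if_pos hp]
  simp only [hv, hc, true_and]
  split_ifs with hw h h
  · exact ⟨h₂, le_rfl⟩
  · push Not at h
    exact ⟨h₁ hw, h.2⟩
  · exact ⟨h₂, le_rfl⟩
  · norm_num at h

theorem key_nonneg {k : ℕ} (h : 0 ≤ D.size k) : 0 ≤ D.key k :=
  div_nonneg h (cases_of_size_nonneg h).1.le

theorem size_eq {k : ℕ} (h : 0 ≤ D.size k) : D.size k = D.key k * D.p k := by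
  rw [key, div_mul_cancel₀ _ (cases_of_size_nonneg h).1.ne']

variable (D)

/-- The keys and sizes of the first items, without those that are never packed. -/
noncomputable def pairs : ℕ → List (ℝ × ℝ)
  | 0 => []
  | k + 1 => pairs k ++ if 0 ≤ D.size k then [(D.key k, D.size k)] else []

theorem length_pairs_le (n : ℕ) : (D.pairs n).length ≤ n := by
  induction n with
  | zero => exact le_rfl
  | succ n ih =>
    simp only [pairs, List.length_append]
    split_ifs <;> simp <;> omega

theorem weight_pairs (n : ℕ) :
    weight (D.pairs n) = ∑ k ∈ Finset.range n, if 0 ≤ D.size k then D.size k else 0 := by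
  induction n with
  | zero => rfl
  | succ n ih =>
    rw [Finset.sum_range_succ, ← ih]
    by_cases h : 0 ≤ D.size n <;> simp [pairs, weight, h]

theorem weightLt_pairs (θ : ℝ) (n : ℕ) : weightLt θ (D.pairs n) =
    ∑ k ∈ Finset.range n, if 0 ≤ D.size k ∧ D.key k < θ then D.size k else 0 := by
  induction n with
  | zero => rfl
  | succ n ih =>
    rw [Finset.sum_range_succ, ← ih]
    by_cases h : 0 ≤ D.size n <;> simp [pairs, weightLt, h]

theorem weightEq_pairs (θ : ℝ) (n : ℕ) : weightEq θ (D.pairs n) =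
    ∑ k ∈ Finset.range n, if 0 ≤ D.size k ∧ D.key k = θ then D.size k else 0 := by
  induction n with
  | zero => rfl
  | succ n ih =>
    rw [Finset.sum_range_succ, ← ih]
    by_cases h : 0 ≤ D.size n <;> simp [pairs, weightEq, h]

/-- The sum of the keys. -/
noncomputable def keySum (n : ℕ) : ℝ := ((D.pairs n).map Prod.fst).sum

/-- Keys are nonnegative, so their sum bounds each of them. This yields a threshold above all keys
using additions alone. -/
theorem key_le_keySum {k n : ℕ} (hk : k < n) (h : 0 ≤ D.size k) : D.key k ≤ D.keySum n := by
  have hsum : D.keySum n = ∑ k ∈ Finset.range n, if 0 ≤ D.size k then D.key k else 0 := by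
    clear hk
    induction n with
    | zero => rfl
    | succ n ih =>
      rw [Finset.sum_range_succ, ← ih]
      by_cases h : 0 ≤ D.size n <;> simp [keySum, pairs, h]
  rw [hsum]
  have := Finset.single_le_sum (s := Finset.range n)
    (f := fun k => if 0 ≤ D.size k then D.key k else 0)
    (fun i _ => by
      split_ifs with hi
      exacts [key_nonneg hi, le_rfl]) (Finset.mem_range.2 hk)
  simpa [h] using this

/-! ### The greedy solution -/

/-- The room that is left for the items of key `θ` after the first items have been considered. -/
noncomputable def room (θ R : ℝ) : ℕ → ℝ
  | 0 => R
  | k + 1 => if 0 ≤ D.size k ∧ D.key k = θ ∧ D.size k ≤ room θ R k then room θ R k - D.size k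
      else room θ R k

/-- The greedy solution packs the items with key below `θ`, and those with key `θ` as long as they
fit into the room left. -/
def Packed (θ R : ℝ) (k : ℕ) : Prop :=
  0 ≤ D.size k ∧ (D.key k < θ ∨ D.key k = θ ∧ D.size k ≤ D.room θ R k)

noncomputable instance (θ R : ℝ) : DecidablePred (D.Packed θ R) := fun _ => Classical.dec _

/-- The items that the greedy solution packs. -/
noncomputable def greedy (θ R : ℝ) (n : ℕ) : Finset ℕ := (Finset.range n).filter (D.Packed θ R)

variable {D}

theorem room_antitone (θ R : ℝ) : Antitone (D.room θ R) :=
  antitone_nat_of_succ_le fun k => by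
    simp only [room]
    split_ifs with h
    · linarith [h.1]
    · exact le_rfl

theorem room_nonneg {θ R : ℝ} (hR : 0 ≤ R) (k : ℕ) : 0 ≤ D.room θ R k := by
  induction k with
  | zero => exact hR
  | succ k ih =>
    simp only [room]
    split_ifs with h
    · linarith [h.2.2]
    · exact ih

/-- All items below the threshold are packed, and each packed item at the threshold takes exactly
its size from the room. -/
theorem size_greedy (θ R : ℝ) (n : ℕ) :
    ∑ k ∈ D.greedy θ R n, D.size k = weightLt θ (D.pairs n) + R - D.room θ R n := by
  rw [weightLt_pairs, greedy, Finset.sum_filter]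
  induction n with
  | zero => simp [room]
  | succ n ih =>
    rw [Finset.sum_range_succ, Finset.sum_range_succ, ih]
    simp only [room, Packed]
    rcases lt_trichotomy (D.key n) θ with h | h | h
    · by_cases h₀ : 0 ≤ D.size n
      · simp [h, h.ne, h₀]
        ring
      · simp [h₀]
    · by_cases h₀ : 0 ≤ D.size n
      · by_cases h₁ : D.size n ≤ D.room θ R n
        · simp [h, h₀, h₁]
          ring
        · simp [h, h₁]
      · simp [h₀]
    · simp [h.ne', h.not_gt]

/-- If the sizes of all items exceed the room, some item of key `θ` does not fit. -/
theorem exists_not_packed {θ R : ℝ} {n : ℕ} (h : IsQuantile (D.pairs n) 1 θ R) :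
    ∃ b < n, 0 ≤ D.size b ∧ D.key b = θ ∧ ¬ D.Packed θ R b ∧
      1 < ∑ k ∈ D.greedy θ R n, D.size k + D.size b := by
  have hsum := D.size_greedy θ R n
  have hroom := h.room
  have hnonneg := D.room_nonneg (θ := θ) h.nonneg n
  by_contra! hb
  have hall : ∀ k < n, 0 ≤ D.size k → D.key k = θ → D.Packed θ R k := by
    intro k hk h₀ hθ
    by_contra hk'
    have h₁ := hb k hk h₀ hθ hk'
    have h₂ : D.room θ R k < D.size k := by
      by_contra! h₂
      exact hk' ⟨h₀, Or.inr ⟨hθ, h₂⟩⟩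
    -- A rejected item exceeds the room at its turn, hence also the final room. Adding it to the
    -- greedy set would then exceed 1, contrary to `h₁`.
    have h₃ := D.room_antitone θ R hk.le
    linarith
  -- If every item of key `θ` is packed, the greedy size exceeds `weightLt + R = 1`, although the
  -- room never becomes negative.
  have : ∑ k ∈ D.greedy θ R n, D.size k = weightLt θ (D.pairs n) + weightEq θ (D.pairs n) := by
    rw [weightLt_pairs, weightEq_pairs, ← Finset.sum_add_distrib, greedy, Finset.sum_filter]
    refine Finset.sum_congr rfl fun k hk => ?_
    rw [Finset.mem_range] at hk
    rcases lt_trichotomy (D.key k) θ with h | h | h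
    · simp [Packed, h, h.ne]
    · by_cases h₀ : 0 ≤ D.size k
      · simp [hall k hk h₀ h, h₀, h]
      · simp [Packed, h₀]
    · simp [Packed, h.ne', h.not_gt]
  linarith [h.lt]

/-- The greedy solution and one more item are at least half as good as any set of twice the
capacity. -/
theorem profit_le_of_isQuantile {θ R : ℝ} {n : ℕ} (h : IsQuantile (D.pairs n) 1 θ R)
    {S : Finset ℕ} (hS : ∀ k ∈ S, k < n ∧ 0 ≤ D.size k) (hsize : ∑ k ∈ S, D.size k ≤ 2) :
    ∃ b < n, 0 ≤ D.size b ∧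
      ∑ k ∈ S, D.p k ≤ 2 * (∑ k ∈ D.greedy θ R n, D.p k + D.p b) := by
  obtain ⟨b, hbn, hb₀, hbθ, hb, hlt⟩ := exists_not_packed h
  refine ⟨b, hbn, hb₀, ?_⟩
  have hsum := D.size_greedy θ R n
  have hroom := h.room
  have hnonneg := D.room_nonneg (θ := θ) h.nonneg n
  have hbp := (cases_of_size_nonneg hb₀).1
  have hbs := size_eq hb₀
  rw [hbθ] at hbs
  -- Greedy has size at most 1 and overflows with `b`, so `size b = θ * p b` is positive.
  have hθ : 0 < θ := by
    by_contra! hθ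
    nlinarith
  -- Lagrangian argument: `θ * p - size = (θ - key) * p` is positive below the threshold, zero at it
  -- and negative above it, so greedy maximizes its sum.
  have hcmp : ∑ k ∈ S, (θ * D.p k - D.size k) ≤
      ∑ k ∈ D.greedy θ R n, (θ * D.p k - D.size k) := by
    have hSn : S = (Finset.range n).filter (· ∈ S) := by
      ext k
      simpa using fun hk => (hS k hk).1
    rw [hSn, greedy, Finset.sum_filter, Finset.sum_filter]
    refine Finset.sum_le_sum fun k _ => ?_
    have hf : 0 ≤ D.size k → 0 < D.p k ∧ θ * D.p k - D.size k = (θ - D.key k) * D.p k :=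
      fun h₀ => ⟨(cases_of_size_nonneg h₀).1, by rw [sub_mul, ← size_eq h₀]⟩
    by_cases hk : k ∈ S <;> by_cases hk' : D.Packed θ R k <;> simp only [hk, hk', if_true, if_false]
    · exact le_rfl
    · obtain ⟨h₁, h₂⟩ := hf (hS k hk).2
      rw [h₂]
      have : θ ≤ D.key k := by
        by_contra! hlt'
        exact hk' ⟨(hS k hk).2, Or.inl hlt'⟩
      exact mul_nonpos_of_nonpos_of_nonneg (by linarith) h₁.le
    · obtain ⟨h₁, h₂⟩ := hf hk'.1
      rw [h₂]
      have : D.key k ≤ θ := hk'.2.elim le_of_lt fun h => h.1.le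
      exact mul_nonneg (by linarith) h₁.le
    · exact le_rfl
  have hle : ∑ k ∈ D.greedy θ R n, D.size k ≤ θ * ∑ k ∈ D.greedy θ R n, D.p k := by
    rw [Finset.mul_sum]
    refine Finset.sum_le_sum fun k hk => ?_
    have hk' := (Finset.mem_filter.1 hk).2
    rw [size_eq hk'.1]
    exact mul_le_mul_of_nonneg_right (hk'.2.elim le_of_lt fun h => h.1.le)
      (cases_of_size_nonneg hk'.1).1.le
  rw [Finset.sum_sub_distrib, Finset.sum_sub_distrib, ← Finset.mul_sum, ← Finset.mul_sum] at hcmp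
  -- With `G` the greedy set, `θ p(S) ≤ θ p(G) + 2 - size(G)`. Inserting `1 < size(G) + θ p(b)`
  -- twice and then `size(G) ≤ θ p(G)` gives `2 θ (p(G) + p(b))`.
  refine le_of_mul_le_mul_left ?_ hθ
  nlinarith

end Table

/-! ### From tables to instances -/

/-- The table of an instance. -/
noncomputable def Instance.table {n : ℕ} (I : Instance n) : Table where
  p k := if h : k < n then I.p ⟨k, h⟩ else 0
  w k := if h : k < n then I.w ⟨k, h⟩ else 0
  v k := if h : k < n then I.wImp ⟨k, h⟩ else 0
  c k := if h : k < n then I.c ⟨k, h⟩ else 0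
  B := I.B
  C := I.C

theorem Instance.valid_table {n : ℕ} (I : Instance n) : I.table.Valid where
  v_nonneg k := by
    simp only [Instance.table]
    split_ifs
    exacts [I.wImp_nonneg _, le_rfl]
  v_le k := by
    simp only [Instance.table]
    split_ifs
    exacts [I.wImp_le _, le_rfl]
  c_nonneg k := by
    simp only [Instance.table]
    split_ifs
    exacts [I.c_nonneg _, le_rfl]
  B_nonneg := I.B_nonneg
  C_nonneg := I.C_nonneg

/-- The packing vector of the set `S`. -/
def packing (n : ℕ) (S : Finset ℕ) : Fin n → ℕ := fun i => if (i : ℕ) ∈ S then 1 else 0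

/-- The improvement vector of the set `S`, each item being packed in the way that its size
suggests. -/
noncomputable def Table.improvement (D : Table) (n : ℕ) (S : Finset ℕ) : Fin n → ℕ :=
  fun i => if (i : ℕ) ∈ S then (D.choice i).2 else 0

theorem total_eq_sum {n : ℕ} {a : Fin n → ℝ} {x : Fin n → ℕ} {S : Finset ℕ} {f : ℕ → ℝ}
    (hS : ∀ k ∈ S, k < n) (h : ∀ i : Fin n, a i * (x i : ℝ) = if (i : ℕ) ∈ S then f i else 0) :
    total a x = ∑ k ∈ S, f k := by
  have hSn : S = (Finset.range n).filter (· ∈ S) := by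
    ext k
    simpa using hS k
  rw [total, Finset.sum_congr rfl fun i _ => h i,
    Fin.sum_univ_eq_sum_range (fun k => if k ∈ S then f k else 0) n, ← Finset.sum_filter, ← hSn]

theorem Instance.total_p_packing {n : ℕ} (I : Instance n) {S : Finset ℕ} (hS : ∀ k ∈ S, k < n) :
    total I.p (packing n S) = ∑ k ∈ S, I.table.p k :=
  total_eq_sum hS fun i => by simp [packing, Instance.table]

/-- The weight that an item contributes. -/
noncomputable def Table.load (D : Table) (k : ℕ) : ℝ :=
  if (D.choice k).2 = 0 then D.w k else D.v k

/-- The cost that an item contributes. -/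
noncomputable def Table.cost (D : Table) (k : ℕ) : ℝ :=
  if (D.choice k).2 = 0 then 0 else D.c k

/-- Treats both modes uniformly: an unimproved item has cost `0`, so its size also has the form load
/ B + cost / C. -/
theorem Table.Valid.load_cost {D : Table} (hD : D.Valid) {k : ℕ} (h : 0 ≤ D.size k) :
    0 ≤ D.load k ∧ D.load k ≤ D.B ∧ 0 ≤ D.cost k ∧ D.cost k ≤ D.C ∧
      D.size k = D.load k / D.B + D.cost k / D.C := by
  have hw := (hD.v_nonneg k).trans (hD.v_le k)
  rcases (Table.cases_of_size_nonneg h).2 with ⟨h₁, h₂, h₃⟩ | ⟨h₁, h₂, h₃, h₄⟩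
  · simp [Table.load, Table.cost, h₁, h₂, h₃, hw, hD.C_nonneg]
  · simp [Table.load, Table.cost, h₁, h₂, h₃, h₄, hD.v_nonneg, hD.c_nonneg]

theorem Instance.feasible_packing {n : ℕ} (I : Instance n) {S : Finset ℕ}
    (hS : ∀ k ∈ S, k < n ∧ 0 ≤ I.table.size k) (hload : ∑ k ∈ S, I.table.load k ≤ I.B)
    (hcost : ∑ k ∈ S, I.table.cost k ≤ I.C) :
    I.Feasible (packing n S) (I.table.improvement n S) := by
  have hbin : ∀ k ∈ S, (I.table.choice k).2 = 0 ∨ (I.table.choice k).2 = 1 := fun k hk =>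
    (Table.cases_of_size_nonneg (hS k hk).2).2.imp (fun h => h.1) fun h => h.1
  refine ⟨?_, ?_, ?_, ?_, ?_⟩
  · refine le_trans (le_of_eq ?_) hload
    rw [total_eq_sum (fun k hk => (hS k hk).1) (f := I.table.w),
      total_eq_sum (fun k hk => (hS k hk).1)
        (f := fun k => (I.table.w k - I.table.v k) * (I.table.choice k).2),
      ← Finset.sum_sub_distrib]
    · refine Finset.sum_congr rfl fun k hk => ?_
      rcases hbin k hk with h | h <;> simp [Table.load, h]
    · intro i
      simp [Table.improvement, Instance.table]
    · intro i
      simp [packing, Instance.table]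
  · refine le_trans (le_of_eq ?_) hcost
    rw [total_eq_sum (fun k hk => (hS k hk).1)
        (f := fun k => I.table.c k * (I.table.choice k).2)]
    · refine Finset.sum_congr rfl fun k hk => ?_
      rcases hbin k hk with h | h <;> simp [Table.cost, h]
    · intro i
      simp [Table.improvement, Instance.table]
  · intro i
    simp only [packing, Table.improvement]
    split_ifs with h
    · rcases hbin i h with h | h <;> omega
    · exact le_rfl
  · intro i
    simp only [packing]
    split_ifs <;> simp
  · intro i
    simp only [Table.improvement]
    split_ifs with h
    · exact hbin i h
    · exact Or.inl rfl

/-- For a zero budget the quotients are all `0` and `h` carries no information; the individual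
bounds `hf` then suffice. -/
theorem sum_le_of_sum_div_le_one {S : Finset ℕ} {f : ℕ → ℝ} {b : ℝ} (hb : 0 ≤ b)
    (hf : ∀ k ∈ S, f k ≤ b) (h : ∑ k ∈ S, f k / b ≤ 1) : ∑ k ∈ S, f k ≤ b := by
  rcases hb.eq_or_lt with rfl | hb
  · exact Finset.sum_nonpos hf
  · rw [← Finset.sum_div, div_le_one hb] at h
    exact h

/-- Two nonnegative sums, of relative loads and of relative costs, add up to at most 1, so each is
at most 1. -/
theorem Instance.feasible_of_size_le_one {n : ℕ} (I : Instance n) {S : Finset ℕ}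
    (hS : ∀ k ∈ S, k < n ∧ 0 ≤ I.table.size k) (h : ∑ k ∈ S, I.table.size k ≤ 1) :
    I.Feasible (packing n S) (I.table.improvement n S) := by
  have hlc := fun k hk => I.valid_table.load_cost (hS k hk).2
  have hsplit : ∑ k ∈ S, I.table.load k / I.B + ∑ k ∈ S, I.table.cost k / I.C ≤ 1 := by
    rw [← Finset.sum_add_distrib]
    exact (Finset.sum_congr rfl fun k hk => (hlc k hk).2.2.2.2.symm).trans_le h
  have h₁ : 0 ≤ ∑ k ∈ S, I.table.load k / I.B :=
    Finset.sum_nonneg fun k hk => div_nonneg (hlc k hk).1 I.B_nonneg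
  have h₂ : 0 ≤ ∑ k ∈ S, I.table.cost k / I.C :=
    Finset.sum_nonneg fun k hk => div_nonneg (hlc k hk).2.2.1 I.C_nonneg
  exact I.feasible_packing hS
    (sum_le_of_sum_div_le_one I.B_nonneg (fun k hk => (hlc k hk).2.1) (by linarith))
    (sum_le_of_sum_div_le_one I.C_nonneg (fun k hk => (hlc k hk).2.2.2.1) (by linarith))

theorem Instance.feasible_singleton {n : ℕ} (I : Instance n) {k : ℕ} (hk : k < n)
    (h : 0 ≤ I.table.size k) : I.Feasible (packing n {k}) (I.table.improvement n {k}) := by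
  have hlc := I.valid_table.load_cost h
  refine I.feasible_packing (fun i hi => ?_) ?_ ?_
  · rw [Finset.mem_singleton.1 hi]
    exact ⟨hk, h⟩
  · rw [Finset.sum_singleton]
    exact hlc.2.1
  · rw [Finset.sum_singleton]
    exact hlc.2.2.2.1

/-- The items of positive profit in an optimal solution have total size at most `2`. -/
theorem Instance.exists_opt_le {n : ℕ} (I : Instance n) :
    ∃ S : Finset ℕ, (∀ k ∈ S, k < n ∧ 0 ≤ I.table.size k) ∧ ∑ k ∈ S, I.table.size k ≤ 2 ∧
      I.opt ≤ ∑ k ∈ S, I.table.p k := by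
  obtain ⟨x, y, h, hv⟩ := I.isGreatest_opt.1
  have hD := I.valid_table
  -- The capacity that item `i` uses in the optimum. All these terms are nonnegative, so each alone
  -- is within `B`.
  let g : Fin n → ℝ := fun i => I.w i * x i - (I.w i - I.wImp i) * y i
  have hxy : ∀ i, (x i = 0 ∧ y i = 0) ∨ (x i = 1 ∧ y i = 0) ∨ (x i = 1 ∧ y i = 1) := fun i => by
    have := h.coupling i
    have := h.binary_x i
    have := h.binary_y i
    omega
  have hg : ∀ i, 0 ≤ g i := fun i => by
    have := I.wImp_nonneg i
    have := I.wImp_le i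
    rcases hxy i with h | h | h <;> simp [g, h] <;> linarith
  have hc : ∀ i, 0 ≤ I.c i * (y i : ℝ) := fun i => mul_nonneg (I.c_nonneg i) (Nat.cast_nonneg _)
  have hgB : ∑ i, g i ≤ I.B := by
    simpa [g, total, Finset.sum_sub_distrib] using h.weight
  have hcC : ∑ i, I.c i * (y i : ℝ) ≤ I.C := h.cost
  have hgi : ∀ i, g i ≤ I.B := fun i =>
    (Finset.single_le_sum (fun j _ => hg j) (Finset.mem_univ i)).trans hgB
  have hci : ∀ i, I.c i * (y i : ℝ) ≤ I.C := fun i =>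
    (Finset.single_le_sum (fun j _ => hc j) (Finset.mem_univ i)).trans hcC
  let F : Finset (Fin n) := Finset.univ.filter fun i => x i = 1 ∧ 0 < I.p i
  -- The mode used by the optimum is admissible for the item alone, so the size is at most the size
  -- in that mode.
  have hsize : ∀ i ∈ F, 0 ≤ I.table.size i ∧
      I.table.size i ≤ g i / I.B + I.c i * (y i : ℝ) / I.C := by
    intro i hi
    obtain ⟨hx, hp⟩ := (Finset.mem_filter.1 hi).2
    have hp' : 0 < I.table.p i := by simpa [Instance.table] using hp
    have hgi := hgi i
    have hci := hci i
    rcases hxy i with h | h | h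
    · omega
    · have := hD.size_le_of_w_le hp' (by simpa [Instance.table, g, h] using hgi)
      simpa [Instance.table, g, h] using this
    · have := hD.size_le_of_v_le hp' (by simpa [Instance.table, g, h] using hgi)
        (by simpa [Instance.table, g, h] using hci)
      simpa [Instance.table, g, h] using this
  refine ⟨F.map Fin.valEmbedding, ?_, ?_, ?_⟩
  · intro k hk
    obtain ⟨i, hi, rfl⟩ := Finset.mem_map.1 hk
    exact ⟨i.2, (hsize i hi).1⟩
  · rw [Finset.sum_map]
    refine (Finset.sum_le_sum fun i hi => (hsize i hi).2).trans ?_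
    refine (Finset.sum_le_sum_of_subset_of_nonneg (Finset.subset_univ F) fun i _ _ =>
      add_nonneg (div_nonneg (hg i) I.B_nonneg) (div_nonneg (hc i) I.C_nonneg)).trans ?_
    rw [Finset.sum_add_distrib, ← Finset.sum_div, ← Finset.sum_div]
    have h₁ := div_le_one_of_le₀ hgB I.B_nonneg
    have h₂ := div_le_one_of_le₀ hcC I.C_nonneg
    linarith
  · rw [Finset.sum_map, hv, total, Finset.sum_filter]
    refine Finset.sum_le_sum fun i _ => ?_
    have hp : I.table.p (Fin.valEmbedding i) = I.p i := by simp [Instance.table]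
    rw [hp]
    rcases h.binary_x i with hx | hx
    · simp [hx]
    · rcases lt_or_ge 0 (I.p i) with hp | hp
      · simp [hx, hp]
      · simp [hx, hp, hp.not_gt]

/-- If all items fit, the greedy solution with a large threshold packs them all. -/
theorem Table.greedy_keySum {D : Table} {n : ℕ} {R : ℝ} :
    D.greedy (D.keySum n + 1) R n = (Finset.range n).filter fun k => 0 ≤ D.size k := by
  ext k
  simp only [Table.greedy, Finset.mem_filter, Finset.mem_range, and_congr_right_iff]
  exact fun hk => ⟨fun h => h.1, fun h =>
    ⟨h, Or.inl (by linarith [D.key_le_keySum hk h])⟩⟩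

/-- The guarantee of the greedy solution, for the threshold that the algorithm chooses. -/
theorem Instance.greedy_spec {n : ℕ} (I : Instance n) {θ R M : ℝ}
    (hθ : weight (I.table.pairs n) ≤ 1 ∧ θ = I.table.keySum n + 1 ∧ R = 0 ∨
      IsQuantile (I.table.pairs n) 1 θ R)
    (hM₀ : 0 ≤ M) (hM : ∀ k < n, 0 ≤ I.table.size k → I.table.p k ≤ M) :
    ∑ k ∈ I.table.greedy θ R n, I.table.size k ≤ 1 ∧
      I.opt ≤ 2 * (∑ k ∈ I.table.greedy θ R n, I.table.p k + M) := by
  obtain ⟨S, hS, hsize, hopt⟩ := I.exists_opt_le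
  rcases hθ with ⟨hw, rfl, rfl⟩ | h
  -- Everything fits: greedy takes every usable item, so it already dominates `S`.
  · rw [Table.greedy_keySum]
    rw [Table.weight_pairs, ← Finset.sum_filter] at hw
    refine ⟨hw, ?_⟩
    have hp : ∀ k, 0 ≤ I.table.size k → 0 ≤ I.table.p k := fun k hk =>
      (Table.cases_of_size_nonneg hk).1.le
    have h₁ := Finset.sum_le_sum_of_subset_of_nonneg (f := I.table.p)
      (fun k hk => Finset.mem_filter.2 ⟨Finset.mem_range.2 (hS k hk).1, (hS k hk).2⟩ :
        S ⊆ (Finset.range n).filter fun k => 0 ≤ I.table.size k)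
      fun k hk _ => hp k (Finset.mem_filter.1 hk).2
    have h₂ := Finset.sum_nonneg fun k hk => hp k (hS k hk).2
    linarith
  · refine ⟨?_, ?_⟩
    · have := Table.size_greedy (D := I.table) θ R n
      have := Table.room_nonneg (D := I.table) (θ := θ) h.nonneg n
      linarith [h.room]
    · obtain ⟨b, hb, hb₀, hle⟩ := Table.profit_le_of_isQuantile h hS hsize
      linarith [hM b hb hb₀]

/-! ### The program

In the passes over the items, natural-number register `5` holds the address of the current item and
register `12` the address of its output cells. Natural-number registers `10` and `11` and real
register `18` describe the most profitable item: the address of its output cells, whether it is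
improved, and its profit. Real registers `19`, `20` and `21` hold the total size, the sum of the
keys, and the profit of the greedy solution. -/

/-- The machine holds the table `D` with `n` items. -/
structure Loaded (D : Table) (n : ℕ) (s : Config) : Prop where
  count : s.nreg 0 = n
  budgets : s.rreg 0 = D.B ∧ s.rreg 1 = D.C
  items : ∀ k < n, s.rmem (4 * k) = D.p k ∧ s.rmem (4 * k + 1) = D.w k ∧
    s.rmem (4 * k + 2) = D.v k ∧ s.rmem (4 * k + 3) = D.c k

theorem Instance.loaded_input {n : ℕ} (I : Instance n) : Loaded I.table n I.input := by
  refine ⟨rfl, ⟨rfl, rfl⟩, fun k hk => ?_⟩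
  have h₀ : 4 * k / 4 = k := by omega
  have h₁ : (4 * k + 1) / 4 = k := by omega
  have h₂ : (4 * k + 2) / 4 = k := by omega
  have h₃ : (4 * k + 3) / 4 = k := by omega
  have g₁ : (4 * k + 1) % 4 = 1 := by omega
  have g₂ : (4 * k + 2) % 4 = 2 := by omega
  have g₃ : (4 * k + 3) % 4 = 3 := by omega
  simp [Instance.input, Instance.table, h₀, h₁, h₂, h₃, g₁, g₂, g₃, hk]

theorem Loaded.congr {D : Table} {n : ℕ} {s s' : Config} (h : Loaded D n s)
    (hn : s'.nreg 0 = s.nreg 0) (hr : ∀ r < 2, s'.rreg r = s.rreg r)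
    (hm : ∀ a < 4 * n, s'.rmem a = s.rmem a) : Loaded D n s' where
  count := hn.trans h.count
  budgets := ⟨(hr 0 (by omega)).trans h.budgets.1, (hr 1 (by omega)).trans h.budgets.2⟩
  items k hk := by
    rw [hm _ (by omega), hm _ (by omega), hm _ (by omega), hm _ (by omega)]
    exact h.items k hk

/-! ### Evaluating and collecting the items -/

/-- Computes the size of an item from its data. -/
def chooseCmd : Cmd :=
  .branch (.realLt 15 10) (
    .branch (.realLe 11 0) (.op (.realDiv 14 11 0)) .skip ;;
    .branch (.realLe 12 0) (.branch (.realLe 13 1) (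
      .op (.realDiv 16 12 0) ;; .op (.realDiv 17 13 1) ;; .op (.realAdd 16 16 17) ;;
      .branch (.realLt 14 15) (.op (.realCopy 14 16) ;; .op (.natConst 9 1))
        (.branch (.realLt 16 14) (.op (.realCopy 14 16) ;; .op (.natConst 9 1)) .skip)) .skip)
      .skip) .skip

/-- Computes the size of the current item, in real register `14`, its key, in real register `16`,
and whether it is improved, in natural-number register `9`. -/
def evaluateCmd : Cmd :=
  .op (.natConst 8 1) ;; .op (.realLoad 10 5) ;; .op (.natAdd 7 5 8) ;; .op (.realLoad 11 7) ;;
  .op (.natAdd 7 7 8) ;; .op (.realLoad 12 7) ;; .op (.natAdd 7 7 8) ;; .op (.realLoad 13 7) ;;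
  .op (.realConst 14 (-1)) ;; .op (.realConst 15 0) ;; .op (.natConst 9 0) ;;
  chooseCmd ;; .op (.realDiv 16 14 10)

/-- The state `s'` of the evaluation of item `k`, started in `s`, when the size found so far is
`t`, with improvement `y`. -/
structure Evaluating (D : Table) (k : ℕ) (s s' : Config) (t : ℝ) (y : ℕ) : Prop where
  nreg : ∀ r, r < 7 ∨ 10 ≤ r → s'.nreg r = s.nreg r
  rreg : ∀ r, r < 10 ∨ 18 ≤ r → s'.rreg r = s.rreg r
  nmem : s'.nmem = s.nmem
  rmem : s'.rmem = s.rmem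
  data : s'.rreg 10 = D.p k ∧ s'.rreg 11 = D.w k ∧ s'.rreg 12 = D.v k ∧ s'.rreg 13 = D.c k
  budgets : s'.rreg 0 = D.B ∧ s'.rreg 1 = D.C
  zero : s'.rreg 15 = 0
  size : s'.rreg 14 = t
  improved : s'.nreg 9 = y

theorem runs_chooseCmd {procs : List Cmd} {D : Table} {k : ℕ} {s s₁ : Config}
    (h₁ : Evaluating D k s s₁ (-1) 0) :
    Runs procs chooseCmd s₁ 14 fun s' => Evaluating D k s s' (D.size k) (D.choice k).2 := by
  refine .branch (K := 13) (fun hp => Runs.mono (K := 2 + 10) (.seq (R := fun s' =>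
    Evaluating D k s s' (if D.w k ≤ D.B then D.w k / D.B else -1) 0) ?_ fun s₂ h₂ => ?_)
    (by omega) fun _ => id) fun hp => Runs.mono (.skip ?_) (show 1 ≤ 13 by omega) fun _ => id
  · refine .branch (K := 1) (fun h => .op ?_) fun h => .skip ?_
    · simp only [Test.Holds, h₁.data, h₁.budgets] at h
      rw [if_pos h]
      constructor
      all_goals simp [Op.apply, Function.update_apply, h₁.data, h₁.budgets, h₁.zero, h₁.improved,
        h₁.nmem, h₁.rmem]
      · exact h₁.nreg
      · have := h₁.rreg
        grind
    · simp only [Test.Holds, h₁.data, h₁.budgets] at h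
      rw [if_neg h]
      exact h₁
  · simp only [Test.Holds, h₁.data, h₁.zero] at hp
    refine .branch (K := 9) (fun hv => .branch (K := 8) (fun hc => ?_) fun hc =>
      Runs.mono (.skip ?_) (show 1 ≤ 8 by omega) fun _ => id) fun hv =>
      Runs.mono (.skip ?_) (show 1 ≤ 9 by omega) fun _ => id
    · simp only [Test.Holds, h₂.data, h₂.budgets] at hv hc
      refine Runs.mono (K := 7) (.op_seq <| .op_seq <| .op_seq <| .branch (K := 3) (fun h =>
        Runs.mono (.op_seq <| .op ?_) (show 1 + 1 ≤ 3 by omega) fun _ => id) fun h =>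
        .branch (K := 2) (fun h' => .op_seq <| .op ?_) fun h' =>
          Runs.mono (.skip ?_) (show 1 ≤ 2 by omega) fun _ => id) (by omega) fun _ => id
      all_goals
        simp [Test.Holds, Op.apply, h₂.data, h₂.budgets, h₂.zero,
          h₂.size] at h
      · have hch : D.choice k = (D.v k / D.B + D.c k / D.C, 1) := by
          rw [Table.choice, if_pos hp, if_pos ⟨hv, hc, Or.inl h⟩]
        rw [Table.size, hch]
        constructor
        all_goals simp [Op.apply, Function.update_apply, h₂.data, h₂.budgets, h₂.zero,
          h₂.nmem, h₂.rmem]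
        · have := h₂.nreg
          grind
        · have := h₂.rreg
          grind
      · simp [Test.Holds, Op.apply, h₂.data, h₂.budgets, h₂.size] at h'
        have hch : D.choice k = (D.v k / D.B + D.c k / D.C, 1) := by
          rw [Table.choice, if_pos hp, if_pos ⟨hv, hc, Or.inr h'⟩]
        rw [Table.size, hch]
        constructor
        all_goals simp [Op.apply, Function.update_apply, h₂.data, h₂.budgets, h₂.zero,
          h₂.nmem, h₂.rmem]
        · have := h₂.nreg
          grind
        · have := h₂.rreg
          grind
      · simp [Test.Holds, Op.apply, h₂.data, h₂.budgets, h₂.size] at h'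
        have hch : D.choice k = (if D.w k ≤ D.B then D.w k / D.B else -1, 0) := by
          rw [Table.choice, if_pos hp, if_neg]
          rintro ⟨-, -, h'' | h''⟩
          · exact absurd h'' h.not_gt
          · exact absurd h'' h'.not_gt
        rw [Table.size, hch]
        constructor
        all_goals simp [Op.apply, Function.update_apply, h₂.data, h₂.budgets, h₂.zero,
          h₂.nmem, h₂.rmem, h₂.size, h₂.improved]
        · exact h₂.nreg
        · have := h₂.rreg
          grind
    all_goals
      have hch : D.choice k = (if D.w k ≤ D.B then D.w k / D.B else -1, 0) := by
        rw [Table.choice, if_pos hp, if_neg]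
        rintro ⟨hv', hc', -⟩
        simp only [Test.Holds, h₂.data, h₂.budgets] at *
        contradiction
      rw [Table.size, hch]
      exact h₂
  · simp only [Test.Holds, h₁.data, h₁.zero] at hp
    have hch : D.choice k = (-1, 0) := by
      rw [Table.choice, if_neg hp]
    rw [Table.size, hch]
    exact h₁

theorem runs_evaluateCmd {procs : List Cmd} {D : Table} {n k : ℕ} {s : Config}
    (hs : Loaded D n s) (hk : k < n) (h5 : s.nreg 5 = 4 * k) :
    Runs procs evaluateCmd s 26 fun s' =>
      Evaluating D k s s' (D.size k) (D.choice k).2 ∧ s'.rreg 16 = D.key k := by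
  obtain ⟨i₀, i₁, i₂, i₃⟩ := hs.items k hk
  obtain ⟨b₀, b₁⟩ := hs.budgets
  refine .op_seq <| .op_seq <| .op_seq <| .op_seq <| .op_seq <| .op_seq <| .op_seq <|
    .op_seq <| .op_seq <| .op_seq <| .op_seq <| .seq (K := 14) (L := 1)
      (runs_chooseCmd (D := D) (k := k) (s := s) ?_) fun s' h => .op ?_
  · constructor
    all_goals simp [Op.apply, Function.update_apply, h5, add_assoc, i₀, i₁, i₂, i₃, b₀, b₁]
    all_goals grind
  · refine ⟨?_, ?_⟩
    · constructor
      all_goals simp [Op.apply, Function.update_apply, h.data, h.budgets, h.zero, h.nmem, h.rmem,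
        h.size, h.improved]
      · exact h.nreg
      · have := h.rreg
        grind
    · simp [Op.apply, Table.key, h.data, h.size]

/-- Appends the current item to the list of pairs. -/
def appendCmd : Cmd :=
  .op (.realStore 2 16) ;; .op (.natConst 7 1) ;; .op (.natAdd 2 2 7) ;; .op (.realStore 2 14) ;;
  .op (.natAdd 2 2 7) ;; .op (.realAdd 19 19 14) ;; .op (.realAdd 20 20 16) ;;
  .branch (.realLt 18 10)
    (.op (.realCopy 18 10) ;; .op (.natCopy 10 12) ;; .op (.natCopy 11 9)) .skip

/-- Writes the list of pairs, and finds its total size, the sum of its keys, and the most profitable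
item. -/
def collectCmd : Cmd :=
  .op (.natAdd 1 0 0) ;; .op (.natAdd 1 1 1) ;; .op (.natCopy 2 1) ;;
  .loop (.natLt 5 1) (
    evaluateCmd ;; .branch (.realLe 15 14) appendCmd .skip ;;
    .op (.natConst 7 4) ;; .op (.natAdd 5 5 7) ;; .op (.natConst 7 2) ;; .op (.natAdd 12 12 7))

/-- Natural-number registers `10` and `11` and real register `18` describe an item of the largest
profit among the first `k` items. -/
structure MostProfitable (D : Table) (k : ℕ) (s : Config) : Prop where
  nonneg : 0 ≤ s.rreg 18
  le : ∀ i < k, 0 ≤ D.size i → D.p i ≤ s.rreg 18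
  eq : s.rreg 18 = 0 ∨ ∃ i < k, 0 ≤ D.size i ∧ s.rreg 18 = D.p i ∧ s.nreg 10 = 2 * i ∧
    s.nreg 11 = (D.choice i).2

theorem MostProfitable.congr {D : Table} {k : ℕ} {s s' : Config} (h : MostProfitable D k s)
    (h18 : s'.rreg 18 = s.rreg 18) (h10 : s'.nreg 10 = s.nreg 10) (h11 : s'.nreg 11 = s.nreg 11) :
    MostProfitable D k s' := by
  obtain ⟨h₁, h₂, h₃⟩ := h
  exact ⟨by rwa [h18], by rwa [h18], by rwa [h18, h10, h11]⟩

/-- What the first `k` items contribute to the list of pairs and its statistics. -/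
structure CollectedData (D : Table) (n k : ℕ) (s : Config) : Prop where
  loaded : Loaded D n s
  start : s.nreg 1 = 4 * n
  listAt : ListAt s.rmem (4 * n) (D.pairs k)
  finish : s.nreg 2 = 4 * n + 2 * (D.pairs k).length
  total : s.rreg 19 = weight (D.pairs k)
  keys : s.rreg 20 = D.keySum k
  best : MostProfitable D k s

theorem runs_append {procs : List Cmd} {D : Table} {n k : ℕ} {s s₁ : Config}
    (h : CollectedData D n k s) (h12 : s.nreg 12 = 2 * k)
    (h₁ : Evaluating D k s s₁ (D.size k) (D.choice k).2) (h16 : s₁.rreg 16 = D.key k) :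
    Runs procs (.branch (.realLe 15 14) appendCmd .skip) s₁ 12 fun s' =>
      CollectedData D n (k + 1) s' ∧ s'.nreg 5 = s.nreg 5 ∧ s'.nreg 12 = s.nreg 12 := by
  obtain ⟨hl, hstart, hlist, hfinish, htotal, hkeys, hbest⟩ := h
  have e1 := h₁.nreg 1 (by omega)
  have e2 := h₁.nreg 2 (by omega)
  have e5 := h₁.nreg 5 (by omega)
  have e10 := h₁.nreg 10 (by omega)
  have e11 := h₁.nreg 11 (by omega)
  have e12 := h₁.nreg 12 (by omega)
  have f18 := h₁.rreg 18 (by omega)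
  have f19 := h₁.rreg 19 (by omega)
  have f20 := h₁.rreg 20 (by omega)
  have hl₁ : Loaded D n s₁ :=
    hl.congr (h₁.nreg 0 (by omega)) (fun r _ => h₁.rreg r (by omega)) fun a _ => by rw [h₁.rmem]
  refine .branch (K := 11) (fun ht => ?_) fun ht => Runs.mono (.skip ?_) (show 1 ≤ 11 by omega)
    fun _ => id
  · simp only [Test.Holds, h₁.zero, h₁.size] at ht
    have hpairs : D.pairs (k + 1) = D.pairs k ++ [(D.key k, D.size k)] := by
      simp [Table.pairs, ht]
    refine .op_seq <| .op_seq <| .op_seq <| .op_seq <| .op_seq <| .op_seq <| .op_seq ?_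
    -- Names the state after the unconditional writes, so that both outcomes of the profit
    -- comparison share the facts about it.
    generalize hs₂ : Op.apply _ _ = s₂
    have h₂ : Loaded D n s₂ ∧ s₂.nreg 1 = 4 * n ∧ ListAt s₂.rmem (4 * n) (D.pairs (k + 1)) ∧
        s₂.nreg 2 = 4 * n + 2 * (D.pairs (k + 1)).length ∧ s₂.rreg 19 = weight (D.pairs (k + 1)) ∧
        s₂.rreg 20 = D.keySum (k + 1) := by
      subst hs₂
      refine ⟨?_, ?_, ?_, ?_, ?_, ?_⟩
      · refine hl₁.congr ?_ ?_ ?_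
        · simp [Op.apply]
        · intro r hr
          simp [Op.apply, Function.update_apply]
          grind
        · intro a ha
          simp [Op.apply, Function.update_apply]
          grind
      · simp [Op.apply, e1, hstart]
      · rw [hpairs]
        refine ListAt.append ?_ ⟨?_, ?_, trivial⟩
        · refine hlist.congr fun i _ hi => ?_
          simp [Op.apply, Function.update_apply, h₁.rmem]
          grind
        · simp [Op.apply, e2, hfinish, h16]
        · simp [Op.apply, e2, hfinish, h₁.size]
      · simp [Op.apply, e2, hfinish, hpairs]
        omega
      · simp [Op.apply, f19, htotal, hpairs, weight, h₁.size]
      · simp [Op.apply, f20, hkeys, hpairs, Table.keySum, h16]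
    have g18 : s₂.rreg 18 = s.rreg 18 := by
      rw [← f18, ← hs₂]; simp [Op.apply]
    have g10 : s₂.rreg 10 = D.p k := by
      rw [← h₁.data.1, ← hs₂]; simp [Op.apply]
    have m5 : s₂.nreg 5 = s.nreg 5 := by
      rw [← e5, ← hs₂]; simp [Op.apply]
    have m9 : s₂.nreg 9 = (D.choice k).2 := by
      rw [← h₁.improved, ← hs₂]; simp [Op.apply]
    have m10 : s₂.nreg 10 = s.nreg 10 := by
      rw [← e10, ← hs₂]; simp [Op.apply]
    have m11 : s₂.nreg 11 = s.nreg 11 := by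
      rw [← e11, ← hs₂]; simp [Op.apply]
    have m12 : s₂.nreg 12 = s.nreg 12 := by
      rw [← e12, ← hs₂]; simp [Op.apply]
    clear hs₂
    obtain ⟨hl₂, h₂⟩ := h₂
    refine .branch (K := 3) (fun ht' => .op_seq <| .op_seq <| .op ?_) fun ht' =>
      Runs.mono (.skip ?_) (show 1 ≤ 3 by omega) fun _ => id
    · simp only [Test.Holds, g18, g10] at ht'
      refine ⟨⟨hl₂.congr ?_ ?_ ?_, ?_, ?_, ?_, ?_, ?_, ⟨?_, ?_, ?_⟩⟩, ?_, ?_⟩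
      all_goals simp [Op.apply, Function.update_apply, h₂, g10, m5, m12]
      · grind
      · exact hbest.nonneg.trans ht'.le
      · intro i hi hi₀
        rcases hi.lt_or_eq with hi | rfl
        · exact (hbest.le i hi hi₀).trans ht'.le
        · exact le_rfl
      · exact Or.inr ⟨k, by omega, ht, rfl, h12, m9⟩
    · simp only [Test.Holds, g18, g10, not_lt] at ht'
      refine ⟨⟨hl₂, h₂.1, h₂.2.1, h₂.2.2.1, h₂.2.2.2.1, h₂.2.2.2.2, ⟨?_, ?_, ?_⟩⟩, m5, m12⟩
      · rw [g18]
        exact hbest.nonneg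
      · intro i hi hi₀
        rw [g18]
        rcases Nat.lt_succ_iff_lt_or_eq.1 hi with hi | rfl
        · exact hbest.le i hi hi₀
        · exact ht'
      · rw [g18, m10, m11]
        exact hbest.eq.imp_right fun ⟨i, hi, h⟩ => ⟨i, by omega, h⟩
  · simp only [Test.Holds, h₁.zero, h₁.size] at ht
    have hpairs : D.pairs (k + 1) = D.pairs k := by
      simp [Table.pairs, ht]
    have hkey : D.keySum (k + 1) = D.keySum k := by
      rw [Table.keySum, hpairs, Table.keySum]
    refine ⟨⟨hl₁, e1.trans hstart, ?_, ?_, ?_, ?_, ⟨?_, ?_, ?_⟩⟩, e5, e12⟩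
    · rwa [hpairs, h₁.rmem]
    · rw [hpairs, e2, hfinish]
    · rw [hpairs, f19, htotal]
    · rw [hkey, f20, hkeys]
    · rw [f18]
      exact hbest.nonneg
    · intro i hi hi₀
      rw [f18]
      rcases Nat.lt_succ_iff_lt_or_eq.1 hi with hi | rfl
      · exact hbest.le i hi hi₀
      · exact absurd hi₀ ht
    · rw [f18, e10, e11]
      exact hbest.eq.imp_right fun ⟨i, hi, h⟩ => ⟨i, by omega, h⟩

theorem runs_collectCmd {procs : List Cmd} {n : ℕ} (I : Instance n) :
    Runs procs collectCmd I.input (45 * n + 4) (CollectedData I.table n n) := by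
  -- Two doublings produce `4 * n`, the first cell behind the items; it is both the start of the
  -- list and the loop bound. Pointers and accumulators rely on the zeros of the initial
  -- configuration.
  refine Runs.mono (.op_seq <| .op_seq <| .op_seq <| Runs.count_loop (K := 26 + (12 + 4)) (n := n)
    (Inv := fun k s => CollectedData I.table n k s ∧ s.nreg 5 = 4 * k ∧ s.nreg 12 = 2 * k)
    ?_ ?_ ?_) (by omega) fun s h => h.1
  · rintro k s hk ⟨h, h5, h12⟩
    simp only [Test.Holds, h5, h.start]
    omega
  · rintro k s hk ⟨h, h5, h12⟩
    refine .seq (runs_evaluateCmd h.loaded hk h5) fun s₁ h₁ => .seq (runs_append h h12 h₁.1 h₁.2)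
      fun s₂ h₂ => .op_seq <| .op_seq <| .op_seq <| .op ?_
    obtain ⟨⟨hl, hstart, hlist, hfinish, htotal, hkeys, hbest⟩, h5', h12'⟩ := h₂
    refine ⟨⟨hl.congr ?_ ?_ ?_, ?_, ?_, ?_, ?_, ?_, hbest.congr ?_ ?_ ?_⟩, ?_, ?_⟩
    all_goals simp [Op.apply, *]
    all_goals omega
  · refine ⟨⟨I.loaded_input.congr ?_ ?_ ?_, ?_, ?_, ?_, ?_, ?_, ⟨?_, ?_, ?_⟩⟩, ?_, ?_⟩
    all_goals simp [Op.apply, Instance.input, Table.pairs, Table.keySum,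
      weight, ListAt]
    all_goals omega

/-! ### The greedy pass -/

/-- Decides whether the greedy solution packs the current item. -/
def packCmd : Cmd :=
  .op (.natConst 13 0) ;; .op (.natConst 14 0) ;;
  .branch (.realLe 15 14) (
    .branch (.realLt 16 3) (.op (.natConst 13 1) ;; .op (.natCopy 14 9) ;; .op (.realAdd 21 21 10))
      (.branch (.realLe 16 3) (.branch (.realLe 14 4)
        (.op (.natConst 13 1) ;; .op (.natCopy 14 9) ;; .op (.realAdd 21 21 10) ;;
          .op (.realSub 4 4 14)) .skip) .skip)) .skip

/-- Writes the greedy solution for the threshold in real register `3` and the room in real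
register `4`. -/
def greedyCmd : Cmd :=
  .op (.natAdd 4 0 0) ;; .op (.natAdd 4 4 4) ;; .op (.natConst 5 0) ;; .op (.natConst 12 0) ;;
  .op (.realConst 21 0) ;;
  .loop (.natLt 5 4) (
    evaluateCmd ;; packCmd ;;
    .op (.natConst 7 1) ;; .op (.natStore 12 13) ;; .op (.natAdd 12 12 7) ;;
    .op (.natStore 12 14) ;; .op (.natAdd 12 12 7) ;; .op (.natConst 7 4) ;; .op (.natAdd 5 5 7))

theorem runs_packCmd {procs : List Cmd} {D : Table} {θ R : ℝ} {k : ℕ} {s s₁ : Config}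
    (h₁ : Evaluating D k s s₁ (D.size k) (D.choice k).2) (h16 : s₁.rreg 16 = D.key k)
    (h3 : s.rreg 3 = θ) (h4 : s.rreg 4 = D.room θ R k) :
    Runs procs packCmd s₁ 10 fun s' =>
      (∀ r, r < 7 ∨ 10 ≤ r ∧ r < 13 → s'.nreg r = s.nreg r) ∧
      (∀ r, r < 4 ∨ 18 ≤ r ∧ r < 21 → s'.rreg r = s.rreg r) ∧
      s'.nmem = s.nmem ∧ s'.rmem = s.rmem ∧ s'.rreg 4 = D.room θ R (k + 1) ∧
      s'.nreg 13 = (if D.Packed θ R k then 1 else 0) ∧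
      s'.nreg 14 = (if D.Packed θ R k then (D.choice k).2 else 0) ∧
      s'.rreg 21 = s.rreg 21 + (if D.Packed θ R k then D.p k else 0) := by
  have f3 := (h₁.rreg 3 (by omega)).trans h3
  have f4 := (h₁.rreg 4 (by omega)).trans h4
  have f21 := h₁.rreg 21 (by omega)
  have hn := h₁.nreg
  have hr := h₁.rreg
  -- Shared by the three ways to reject an item: no admissible mode or no profit, key above the
  -- threshold, or not enough room.
  have hskip : ¬ D.Packed θ R k → (0 ≤ D.size k → D.key k ≠ θ ∨ D.room θ R k < D.size k) →
      ∀ s₂ : Config, s₂ = Op.apply (Op.apply s₁ (.natConst 13 0)) (.natConst 14 0) →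
      (∀ r, r < 7 ∨ 10 ≤ r ∧ r < 13 → s₂.nreg r = s.nreg r) ∧
      (∀ r, r < 4 ∨ 18 ≤ r ∧ r < 21 → s₂.rreg r = s.rreg r) ∧
      s₂.nmem = s.nmem ∧ s₂.rmem = s.rmem ∧ s₂.rreg 4 = D.room θ R (k + 1) ∧
      s₂.nreg 13 = (if D.Packed θ R k then 1 else 0) ∧
      s₂.nreg 14 = (if D.Packed θ R k then (D.choice k).2 else 0) ∧
      s₂.rreg 21 = s.rreg 21 + (if D.Packed θ R k then D.p k else 0) := by
    rintro hp hroom s₂ rfl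
    have hroom' : D.room θ R (k + 1) = D.room θ R k := by
      rw [Table.room, if_neg]
      rintro ⟨h, h', h''⟩
      exact (hroom h).elim (fun g => g h') fun g => h''.not_gt g
    simp [Op.apply, Function.update_apply, hp, hroom', f4, f21, h₁.nmem, h₁.rmem]
    grind
  refine Runs.mono (K := 7 + 1 + 1 + 1) (.op_seq <| .op_seq <| .branch (fun ht => ?_) fun ht =>
    Runs.mono (.skip (hskip ?_ ?_ _ rfl)) (show 1 ≤ 7 by omega) fun _ => id) le_rfl fun _ => id
  · simp [Test.Holds, Op.apply, h₁.zero, h₁.size] at ht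
    refine .branch (K := 6) (fun hlt => ?_) fun hlt => .branch (K := 5) (fun hle =>
      .branch (K := 4) (fun hfit => ?_) fun hfit =>
        Runs.mono (.skip (hskip ?_ ?_ _ rfl)) (show 1 ≤ 4 by omega) fun _ => id) fun hle =>
      Runs.mono (.skip (hskip ?_ ?_ _ rfl)) (show 1 ≤ 5 by omega) fun _ => id
    all_goals simp [Test.Holds, Op.apply, h16, f3] at hlt
    · refine Runs.mono (.op_seq <| .op_seq <| .op ?_) (show 1 + 1 + 1 ≤ 6 by omega) fun _ => id
      have hp : D.Packed θ R k := ⟨ht, Or.inl hlt⟩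
      have hroom : D.room θ R (k + 1) = D.room θ R k := by
        rw [Table.room, if_neg]
        exact fun h => hlt.ne h.2.1
      simp [Op.apply, Function.update_apply, hp, hroom, f4, f21, h₁.nmem, h₁.rmem, h₁.data,
        h₁.improved]
      grind
    · refine .op_seq <| .op_seq <| .op_seq <| .op ?_
      simp [Test.Holds, Op.apply, h16, f3] at hle
      simp [Test.Holds, Op.apply, h₁.size, f4] at hfit
      have heq := le_antisymm hle hlt
      have hp : D.Packed θ R k := ⟨ht, Or.inr ⟨heq, hfit⟩⟩
      have hroom : D.room θ R (k + 1) = D.room θ R k - D.size k := by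
        rw [Table.room, if_pos ⟨ht, heq, hfit⟩]
      simp [Op.apply, Function.update_apply, hp, hroom, f4, f21, h₁.nmem, h₁.rmem, h₁.data,
        h₁.improved, h₁.size]
      grind
    · simp [Test.Holds, Op.apply, h₁.size, f4] at hfit
      exact fun h => h.2.elim (fun g => hlt.not_gt g) fun g => g.2.not_gt hfit
    · simp [Test.Holds, Op.apply, h₁.size, f4] at hfit
      exact fun _ => Or.inr hfit
    · simp [Test.Holds, Op.apply, h16, f3] at hle
      exact fun h => h.2.elim (fun g => hlt.not_gt g) fun g => hle.ne' g.1
    · simp [Test.Holds, Op.apply, h16, f3] at hle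
      exact fun _ => Or.inl hle.ne'
  all_goals simp [Test.Holds, Op.apply, h₁.zero, h₁.size] at ht
  · exact fun h => ht.not_ge h.1
  · exact fun h => absurd h ht.not_ge

/-- The output cells of the first `k` items encode the set `S`. -/
def Encodes (D : Table) (S : Finset ℕ) (k : ℕ) (s : Config) : Prop :=
  ∀ i < k, s.nmem (2 * i) = (if i ∈ S then 1 else 0) ∧
    s.nmem (2 * i + 1) = if i ∈ S then (D.choice i).2 else 0

/-- Both output cells of every item are written, whatever they held before. This erases remnants of
the selection stack, which shares this memory, and allows the pass to be repeated. -/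
theorem runs_greedyCmd {procs : List Cmd} {D : Table} {n : ℕ} {s : Config} (hs : Loaded D n s) :
    Runs procs greedyCmd s (46 * n + 6) fun s' =>
      Loaded D n s' ∧ Encodes D (D.greedy (s.rreg 3) (s.rreg 4) n) n s' ∧
      s'.rreg 21 = ∑ k ∈ D.greedy (s.rreg 3) (s.rreg 4) n, D.p k ∧
      s'.rreg 18 = s.rreg 18 ∧ s'.nreg 10 = s.nreg 10 ∧ s'.nreg 11 = s.nreg 11 := by
  generalize hθ : s.rreg 3 = θ
  generalize hR : s.rreg 4 = R
  refine Runs.mono (.op_seq <| .op_seq <| .op_seq <| .op_seq <| .op_seq <|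
    Runs.count_loop (K := 26 + (10 + 7)) (n := n) (Inv := fun k s' => Loaded D n s' ∧
      s'.nreg 4 = 4 * n ∧ s'.nreg 5 = 4 * k ∧ s'.nreg 12 = 2 * k ∧ s'.rreg 3 = θ ∧
      s'.rreg 4 = D.room θ R k ∧
      s'.rreg 21 = ∑ i ∈ Finset.range k, (if D.Packed θ R i then D.p i else 0) ∧
      (∀ i < k, s'.nmem (2 * i) = (if D.Packed θ R i then 1 else 0) ∧
        s'.nmem (2 * i + 1) = if D.Packed θ R i then (D.choice i).2 else 0) ∧
      s'.rreg 18 = s.rreg 18 ∧ s'.nreg 10 = s.nreg 10 ∧ s'.nreg 11 = s.nreg 11)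
    ?_ ?_ ?_) (by omega) ?_
  · rintro k s' hk ⟨-, h4, h5, -⟩
    simp only [Test.Holds, h4, h5]
    omega
  · rintro k s' hk ⟨hl, h4, h5, h12, f3, f4, f21, hmem, f18, h10, h11⟩
    refine .seq (runs_evaluateCmd hl hk h5) fun s₁ h₁ => .seq (runs_packCmd h₁.1 h₁.2 f3 f4)
      fun s₂ h₂ => .op_seq <| .op_seq <| .op_seq <| .op_seq <| .op_seq <| .op_seq <| .op ?_
    obtain ⟨hn, hr, hnm, hrm, g4, g13, g14, g21⟩ := h₂
    have n0 := hn 0 (by omega)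
    have n4 := hn 4 (by omega)
    have n5 := hn 5 (by omega)
    have n10 := hn 10 (by omega)
    have n11 := hn 11 (by omega)
    have n12 := hn 12 (by omega)
    have r3 := hr 3 (by omega)
    have r18 := hr 18 (by omega)
    refine ⟨hl.congr ?_ ?_ ?_, ?_, ?_, ?_, ?_, ?_, ?_, ?_, ?_, ?_, ?_⟩
    · simp [Op.apply, n0]
    · intro r h
      simpa [Op.apply] using hr r (by omega)
    · simp [Op.apply, hrm]
    · simp [Op.apply, n4, h4]
    · simp [Op.apply, n5, h5]
      omega
    · simp [Op.apply, n12, h12]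
      omega
    · simp [Op.apply, r3, f3]
    · simp [Op.apply, g4]
    · rw [Finset.sum_range_succ, ← f21, ← g21]
      simp [Op.apply]
    · intro i hi
      rcases Nat.lt_succ_iff_lt_or_eq.1 hi with hi | rfl
      · have h₁ : 2 * i ≠ 2 * k + 1 := by omega
        have h₂ : 2 * i ≠ 2 * k := by omega
        have h₄ : 2 * i + 1 ≠ 2 * k := by omega
        simp only [Op.apply, Function.update_apply, n12, h12, hnm]
        simp [h₁, h₂, h₄, hmem i hi]
      · simp [Op.apply, n12, h12, g13, g14]
    · simp [Op.apply, r18, f18]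
    · simp [Op.apply, n10, h10]
    · simp [Op.apply, n11, h11]
  · refine ⟨hs.congr ?_ ?_ ?_, ?_⟩
    all_goals simp [Op.apply, Function.update_apply, hs.count, hθ, hR, Table.room]
    all_goals grind
  · rintro s' ⟨hl, -, -, -, -, -, f21, hmem, f18, h10, h11⟩
    refine ⟨hl, fun i hi => ?_, ?_, f18, h10, h11⟩
    · simpa [Table.greedy, hi] using hmem i hi
    · rw [f21, Table.greedy, Finset.sum_filter]

/-! ### Threshold, output and the final guarantee -/

/-- Finds the threshold and the room of the greedy solution. -/
def thresholdCmd : Cmd :=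
  .op (.realConst 4 1) ;;
  .branch (.realLe 19 4) (.op (.realAdd 3 20 4) ;; .op (.realConst 4 0))
    (.op (.realCopy 2 4) ;; .call 0)

/-- If the total size is at most 1, a threshold above all keys packs everything. Otherwise level 1
is below the total weight, which is what selection requires. -/
theorem runs_thresholdCmd {procs : List Cmd} (hp : procs[0]? = some selectCmd) {D : Table} {n : ℕ}
    {s : Config} (h : CollectedData D n n s) :
    Runs procs thresholdCmd s (1000 * n + 4) fun s' =>
      Loaded D n s' ∧ MostProfitable D n s' ∧
      (weight (D.pairs n) ≤ 1 ∧ s'.rreg 3 = D.keySum n + 1 ∧ s'.rreg 4 = 0 ∨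
        IsQuantile (D.pairs n) 1 (s'.rreg 3) (s'.rreg 4)) := by
  obtain ⟨hl, hstart, hlist, hfinish, htotal, hkeys, hbest⟩ := h
  refine Runs.mono (K := 1000 * n + 2 + 1 + 1) (.op_seq <| .branch
    (fun ht => Runs.mono (.op_seq <| .op ?_) (show 1 + 1 ≤ _ by omega) fun _ => id) fun ht =>
      Runs.mono (.op_seq <| Runs.mono
        (runs_select hp ((D.pairs n).length + 1) (D.pairs n) _ (Nat.lt_succ_self _)
          ⟨?_, ?_⟩ ?_ ?_) (Nat.mul_le_mul_left 1000 (D.length_pairs_le n)) fun s' h => ?_)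
        (by omega) fun _ => id) (by omega) fun _ => id
  · simp [Test.Holds, Op.apply, htotal] at ht
    refine ⟨hl.congr ?_ ?_ ?_, hbest.congr ?_ ?_ ?_, Or.inl ⟨ht, ?_, ?_⟩⟩
    all_goals simp [Op.apply, Function.update_apply, hkeys]
    grind
  · simpa [Op.apply, hstart] using hlist
  · simpa [Op.apply, hstart] using hfinish
  · simp [Op.apply]
  · simpa [Test.Holds, Op.apply, htotal] using ht
  · have hq := h.quantile
    have hrm := h.rmem
    have h18 := h.rreg 18 (by omega)
    have hr := h.rreg
    simp [Op.apply, Function.update_apply, hstart] at hq hrm h18 hr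
    refine ⟨hl.congr ?_ ?_ ?_, hbest.congr h18 ?_ ?_, Or.inr hq⟩
    · exact h.nreg 0 (by omega)
    · grind
    · exact hrm
    · exact h.nreg 10 (by omega)
    · exact h.nreg 11 (by omega)

/-- Writes the better one of the greedy solution and the most profitable item. -/
def outputCmd : Cmd :=
  greedyCmd ;;
  .branch (.realLt 21 18) (.op (.realConst 3 (-1)) ;; greedyCmd ;; .op (.natConst 7 1) ;;
    .op (.natStore 10 7) ;; .op (.natAdd 10 10 7) ;; .op (.natStore 10 11)) .skip

/-- Keys are nonnegative. Rerunning the pass with threshold `-1` therefore clears the output. -/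
theorem Table.greedy_of_neg (D : Table) {θ : ℝ} (hθ : θ < 0) (R : ℝ) (n : ℕ) :
    D.greedy θ R n = ∅ := by
  refine Finset.filter_eq_empty_iff.2 fun k _ h => ?_
  have := Table.key_nonneg h.1
  have : D.key k ≤ θ := h.2.elim le_of_lt fun h => h.1.le
  linarith

theorem runs_outputCmd {procs : List Cmd} {D : Table} {n : ℕ} {s : Config} (hs : Loaded D n s)
    (hbest : MostProfitable D n s) :
    Runs procs outputCmd s (92 * n + 20) fun s' => ∃ S, Encodes D S n s' ∧
      (S = D.greedy (s.rreg 3) (s.rreg 4) n ∨ ∃ i < n, 0 ≤ D.size i ∧ S = {i}) ∧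
      ∑ k ∈ D.greedy (s.rreg 3) (s.rreg 4) n, D.p k ≤ ∑ k ∈ S, D.p k ∧
      s.rreg 18 ≤ ∑ k ∈ S, D.p k := by
  refine Runs.mono (K := (46 * n + 6) + (46 * n + 11 + 1)) (.seq (runs_greedyCmd hs) fun s₁ h₁ =>
    .branch (fun ht => Runs.mono (.op_seq <| .seq (runs_greedyCmd (D := D) (n := n) ?_)
      fun s₂ h₂ => .op_seq <| .op_seq <| .op_seq <| .op ?_) (show _ ≤ _ from ?_) fun _ => id)
      fun ht => Runs.mono (.skip ?_) (show 1 ≤ _ by omega) fun _ => id) (by omega) fun _ => id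
  · refine h₁.1.congr ?_ ?_ ?_
    all_goals simp [Op.apply, Function.update_apply]
    grind
  · obtain ⟨-, -, h21, h18, h10, h11⟩ := h₁
    simp only [Test.Holds, h21, h18] at ht
    have hP : 0 ≤ ∑ k ∈ D.greedy (s.rreg 3) (s.rreg 4) n, D.p k :=
      Finset.sum_nonneg fun k hk =>
        (Table.cases_of_size_nonneg (Finset.mem_filter.1 hk).2.1).1.le
    -- The recorded profit exceeds the nonnegative greedy profit, so it is not the initial `0` and
    -- belongs to an actual item.
    obtain ⟨i, hi, hi₀, hM, g10, g11⟩ := hbest.eq.resolve_left (by linarith)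
    refine ⟨{i}, ?_, Or.inr ⟨i, hi, hi₀, rfl⟩, ?_, ?_⟩
    · obtain ⟨-, henc, -, -, k10, k11⟩ := h₂
      have e10 : s₂.nreg 10 = 2 * i := by simpa [Op.apply, h10, g10] using k10
      have e11 : s₂.nreg 11 = (D.choice i).2 := by simpa [Op.apply, h11, g11] using k11
      rw [D.greedy_of_neg (by simp [Op.apply])] at henc
      intro j hj
      obtain ⟨m₀, m₁⟩ := henc j hj
      simp only [Finset.notMem_empty, if_false] at m₀ m₁
      by_cases hij : j = i
      · subst hij
        simp [Op.apply, e10, e11]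
      · have h₁ : 2 * j ≠ 2 * i + 1 := by omega
        have h₂ : 2 * j + 1 ≠ 2 * i := by omega
        simp [Op.apply, e10, h₁, h₂, hij, m₀, m₁]
    · rw [Finset.sum_singleton, ← hM]
      exact ht.le
    · rw [Finset.sum_singleton, ← hM]
  · omega
  · obtain ⟨-, henc, h21, h18, -, -⟩ := h₁
    simp only [Test.Holds, h21, h18, not_lt] at ht
    exact ⟨_, henc, Or.inl rfl, le_rfl, ht⟩

/-- The approximation algorithm. -/
def approximation : Program where
  procs := [selectCmd]
  main := collectCmd ;; thresholdCmd ;; outputCmd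

theorem Encodes.out_eq {n : ℕ} {D : Table} {S : Finset ℕ} {s : Config} (h : Encodes D S n s) :
    s.outX n = packing n S ∧ s.outY n = D.improvement n S :=
  ⟨funext fun i => (h i i.2).1, funext fun i => (h i i.2).2⟩

theorem approximation_isLinearTimeApprox : approximation.IsLinearTimeApprox 6 := by
  -- The three phases take at most `1137 * n + 28` steps. The ratio obtained is 4, and nonnegativity
  -- of the profit weakens it to 6.
  refine ⟨2000, fun n I => ?_⟩
  obtain ⟨k, s, hexec, hk, S, henc, hfeas, hlt, hnonneg, hopt⟩ :
      Runs approximation.procs approximation.main I.input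
        ((45 * n + 4) + ((1000 * n + 4) + (92 * n + 20))) fun s => ∃ S, Encodes I.table S n s ∧
          I.Feasible (packing n S) (I.table.improvement n S) ∧
          (∀ k ∈ S, k < n) ∧ 0 ≤ ∑ k ∈ S, I.table.p k ∧ I.opt ≤ 4 * ∑ k ∈ S, I.table.p k := by
    refine .seq (runs_collectCmd I) fun s₁ h₁ => .seq (runs_thresholdCmd rfl h₁) fun s₂ h₂ => ?_
    obtain ⟨hl, hbest, hθ⟩ := h₂
    obtain ⟨hsize, hopt⟩ := I.greedy_spec hθ hbest.nonneg hbest.le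
    refine (runs_outputCmd hl hbest).mono le_rfl fun s' ⟨S, henc, hS, hP, hM⟩ => ?_
    refine ⟨S, henc, ?_, ?_, hbest.nonneg.trans hM, by linarith⟩
    · rcases hS with rfl | ⟨i, hi, hi₀, rfl⟩
      · exact I.feasible_of_size_le_one (fun k hk =>
          ⟨Finset.mem_range.1 (Finset.mem_filter.1 hk).1, (Finset.mem_filter.1 hk).2.1⟩) hsize
      · exact I.feasible_singleton hi hi₀
    · rcases hS with rfl | ⟨i, hi, hi₀, rfl⟩
      · exact fun k hk => Finset.mem_range.1 (Finset.mem_filter.1 hk).1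
      · simpa using hi
  refine ⟨k, s, hexec, by omega, ?_⟩
  rw [henc.out_eq.1, henc.out_eq.2, I.total_p_packing hlt]
  exact ⟨hfeas, by linarith⟩

end ImprovableKnapsack

theorem mainTheorem4 :
    (∀ (n : ℕ) (I : ImprovableKnapsack.Instance n),
      I.opt ≤ 2 * max (ImprovableKnapsack.mkpOpt I.p I.wImp I.c I.B I.C)
        (ImprovableKnapsack.kpOpt I.p I.w I.B)) ∧
    (∀ (n : ℕ) (I : ImprovableKnapsack.Instance n) (z₁ z₂ : Fin n → ℕ),
      ImprovableKnapsack.MKPFeasible I.wImp I.c I.B I.C z₁ →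
      ImprovableKnapsack.mkpOpt I.p I.wImp I.c I.B I.C ≤ 3 * ImprovableKnapsack.total I.p z₁ →
      ImprovableKnapsack.KPFeasible I.w I.B z₂ →
      ImprovableKnapsack.kpOpt I.p I.w I.B ≤ 2 * ImprovableKnapsack.total I.p z₂ →
      I.Feasible z₁ z₁ ∧ I.Feasible z₂ 0 ∧
        I.opt ≤ 6 * max (ImprovableKnapsack.total I.p z₁) (ImprovableKnapsack.total I.p z₂)) ∧
    ∃ P : ImprovableKnapsack.Program, P.IsLinearTimeApprox 6 :=
  ⟨fun _ I => I.opt_le_two_mul_max,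
    fun _ I _ _ h₁ hz₁ h₂ hz₂ => ⟨h₁.feasible, h₂.feasible, I.opt_le_six_mul_max hz₁ hz₂⟩,
    _, ImprovableKnapsack.approximation_isLinearTimeApprox⟩
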